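/- **Setting.** Let $G=(V,E)$ be a finite simple graph and let $\Delta\in\mathbb N$ be such that every node $v$ has degree $d_v\le\Delta$. Each node $v$ has a palette $\Psi_v$ of exactly $d_v+1$ colors from a finite color space. Write $N(v)$ for the neighborhood of $v$, and $m(S)$ for the number of edges with both endpoints in $S$. Define - the sparsity $\zeta_v=\frac1{d_v}\bigl[\binom{d_v}{2}-m(N(v))\bigr]$ (read as $0$ if $d_v=0$), - the unevenness $\eta_v=\sum_{u\in N(v)}\frac{\max(0,d_u-d_v)}{d_u+1}$, - the discrepancy $\bar\eta_v=\sum_{u\in N(v)}|\Psi_u\setminus\Psi_v|/|\Psi_u|$, - the slackability $\bar\sigma_v=\zeta_v+\bar\eta_v$. Let $\varepsilon_{ac},\varepsilon_{sp}\in(0,1)$. Let $V=V_{sp}\sqcup V_{un}\sqcup\bigsqcup_{C\in\mathcal C}C$ be an almost-clique decomposition, that is, a partition with nonempty almost-cliques $C\in\mathcal C$ such that $\zeta_v\ge\varepsilon_{sp}d_v$ for $v\in V_{sp}$, $\eta_v\ge\varepsilon_{sp}d_v$ for $v\in V_{un}$, and $d_v\le(1+\varepsilon_{ac})|C|$ and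 $(1+\varepsilon_{ac})|N(v)\cap C|\ge|C|$ for all $v\in C\in\mathcal C$. For $C\in\mathcal C$ put $\bar\sigma_C=\min_{v\in C}\bar\sigma_v$, and let $\ell=\log_2^{2.1}\Delta$. The almost-clique $C$ is *low-slack* if $\bar\sigma_C\le\ell$ and *high-slack* if $\bar\sigma_C>\ell$. *Slack generation:* independently, each node is sampled with probability $1/10$, and each sampled node $v$ tries a uniformly random color of $\Psi_v$. It permanently adopts this color if no node of $N^+(v)$ tries the same color. Here $N^+(v)\subseteq N(v)$ are fixed sets (in the basic version $N^+(v)=N(v)$) such that on every edge $uv$ we have $u\in N^+(v)$ or $v\in N^+(u)$. For $v\in C$ let $e_v=|N(v)\setminus C|$ be the external degree and $a_v=|C\setminus(N(v)\cup\{v\})|$ the anti-degree. Let $\kappa_v$ be the chromatic slack: the number of neighbors of $v$ in $C$ that adopt a permanent color outside of $\Psi_v$ during slack generation. **Lemma.** There are constants $K,c>0$ depending only on $\varepsilon_{ac},\varepsilon_{sp}$ such that the following holds for all $G,\Delta,\Psi,N^+$, decompositions and almost-cliques $C$ as above. Let the leader of $C$ be a node $x\in C$ that minimizes $e_v+a_v+\kappa_v$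 over $v\in C$, with ties broken arbitrarily. 1. If $C$ is high-slack, then with probability at least $1-\exp(-c\,\bar\sigma_C)$ we have $\bar\sigma_x\le K\bar\sigma_C$. 2. If $C$ is low-slack, then with probability at least $1-\exp(-c\,\ell)$ we have $\bar\sigma_x\le K\ell$. More precisely, the stated event holds simultaneously for all minimizers $x$. The same is true, with the same constants, if $\kappa_v$ counts all neighbors of $v$, not only those in $C$. -/

import Mathlib

open MeasureTheory

/-! ### Sparsity, discrepancy, unevenness, slackability -/

/-- `m(S)`: the number of edges of `G` with both endpoints in `S`. -/
def edgesWithin {V : Type*} [Fintype V] [DecidableEq V] (G : SimpleGraph V) [DecidableRel G.Adj]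
    (S : Finset V) : ℕ :=
  (G.edgeFinset ∩ S.sym2).card

/-- Local sparsity `ζ_v = (1 / d_v) * (binom(d_v, 2) - m(N(v)))`. -/
noncomputable def sparsity {V : Type*} [Fintype V] [DecidableEq V] (G : SimpleGraph V)
    [DecidableRel G.Adj] (v : V) : ℝ :=
  (1 / (G.degree v : ℝ)) *
    (((G.degree v).choose 2 : ℝ) - (edgesWithin G (G.neighborFinset v) : ℝ))

/-- Unevenness `∑_{u ∈ N(v)} max(0, d_u - d_v) / (d_u + 1)`. -/
noncomputable def unevenness {V : Type*} [Fintype V] (G : SimpleGraph V)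
    [DecidableRel G.Adj] (v : V) : ℝ :=
  ∑ u ∈ G.neighborFinset v,
    max 0 ((G.degree u : ℝ) - (G.degree v : ℝ)) / ((G.degree u : ℝ) + 1)

/-- Disparity of `u` towards `v`: `|Ψ_u \ Ψ_v| / |Ψ_u|`, where `Ψ` assigns palettes. -/
noncomputable def disparity {V 𝒞 : Type*} [DecidableEq 𝒞] (Ψ : V → Finset 𝒞) (u v : V) : ℝ :=
  ((Ψ u \ Ψ v).card : ℝ) / ((Ψ u).card : ℝ)

/-- Discrepancy of `v`: the sum over the neighbors `u` of the disparity of `u` towards `v`. -/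
noncomputable def discrepancy {V 𝒞 : Type*} [Fintype V] [DecidableEq 𝒞] (G : SimpleGraph V)
    [DecidableRel G.Adj] (Ψ : V → Finset 𝒞) (v : V) : ℝ :=
  ∑ u ∈ G.neighborFinset v, disparity Ψ u v

/-- Slackability of a node: sparsity plus discrepancy. -/
noncomputable def slackability {V 𝒞 : Type*} [Fintype V] [DecidableEq V] [DecidableEq 𝒞]
    (G : SimpleGraph V) [DecidableRel G.Adj] (Ψ : V → Finset 𝒞) (v : V) : ℝ :=
  sparsity G v + discrepancy G Ψ v

/-- Slackability of a (nonempty) set of nodes: the minimum slackability of its members. -/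
noncomputable def cliqueSlackability {V 𝒞 : Type*} [Fintype V] [DecidableEq V] [DecidableEq 𝒞]
    (G : SimpleGraph V) [DecidableRel G.Adj] (Ψ : V → Finset 𝒞) (C : Finset V) : ℝ :=
  sInf (slackability G Ψ '' (C : Set V))

/-- The threshold `ℓ = log^{2.1} Δ` (binary logarithm). -/
noncomputable def slackThreshold (Δ : ℕ) : ℝ := (Real.logb 2 (Δ : ℝ)) ^ (2.1 : ℝ)

/-! ### Almost-clique decompositions -/

/-- `V = Vsp ⊔ Vun ⊔ ⨆ cliques` is a (degree+1) almost-clique decomposition of `G`. -/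
structure IsACD {V : Type*} [Fintype V] [DecidableEq V] (G : SimpleGraph V) [DecidableRel G.Adj]
    (εacd εsp : ℝ) (Vsp Vun : Finset V) (cliques : Finset (Finset V)) : Prop where
  disjoint_sp_un : Disjoint Vsp Vun
  disjoint_sp : ∀ C ∈ cliques, Disjoint Vsp C
  disjoint_un : ∀ C ∈ cliques, Disjoint Vun C
  nonempty : ∀ C ∈ cliques, C.Nonempty
  pairwise_disjoint : ∀ C ∈ cliques, ∀ C' ∈ cliques, C ≠ C' → Disjoint C C'
  cover : ∀ v : V, v ∈ Vsp ∨ v ∈ Vun ∨ ∃ C ∈ cliques, v ∈ C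
  sparse : ∀ v ∈ Vsp, εsp * (G.degree v : ℝ) ≤ sparsity G v
  uneven : ∀ v ∈ Vun, εsp * (G.degree v : ℝ) ≤ unevenness G v
  degree_le : ∀ C ∈ cliques, ∀ v ∈ C, (G.degree v : ℝ) ≤ (1 + εacd) * (C.card : ℝ)
  card_le : ∀ C ∈ cliques, ∀ v ∈ C,
    (C.card : ℝ) ≤ (1 + εacd) * ((G.neighborFinset v ∩ C).card : ℝ)

/-- External degree `e_v = |N(v) \ C|` of a node of `C`. -/
def externalDegree {V : Type*} [Fintype V] [DecidableEq V] (G : SimpleGraph V)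
    [DecidableRel G.Adj] (C : Finset V) (v : V) : ℕ :=
  (G.neighborFinset v \ C).card

/-- Anti-degree `a_v`: the number of nodes of `C`, other than `v`, not adjacent to `v`. -/
def antiDegree {V : Type*} [Fintype V] [DecidableEq V] (G : SimpleGraph V)
    [DecidableRel G.Adj] (C : Finset V) (v : V) : ℕ :=
  (C \ insert v (G.neighborFinset v)).card

/-! ### Slack generation

An outcome `ω` records for each node `v` whether `v` is sampled (`(ω v).1`) and the random color
`(ω v).2` of its palette, which `v` tries if it is sampled. -/

/-- Law of the pair drawn by one node with palette `P`: it is sampled with probability `1/10`,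
and its color is independent of that and uniform in `P`. -/
noncomputable def nodeLaw {𝒞 : Type*} [MeasurableSpace 𝒞] (P : Finset 𝒞) : Measure (Bool × 𝒞) :=
  ((1 / 10 : ENNReal) • Measure.dirac true + (9 / 10 : ENNReal) • Measure.dirac false).prod
    (ProbabilityTheory.uniformOn (P : Set 𝒞))

/-- Law of all choices made in slack generation: the nodes draw independently. -/
noncomputable def slackGenerationLaw {V 𝒞 : Type*} [Fintype V] [MeasurableSpace 𝒞]
    (Ψ : V → Finset 𝒞) : Measure (V → Bool × 𝒞) :=
  Measure.pi fun v => nodeLaw (Ψ v)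

/-- `Np v = N⁺(v)` is the set of neighbors whose tried colors conflict with that of `v`; on each
edge, at least one endpoint conflicts with the other. -/
def IsConflictRelation {V : Type*} [Fintype V] (G : SimpleGraph V) [DecidableRel G.Adj]
    (Np : V → Finset V) : Prop :=
  (∀ v, Np v ⊆ G.neighborFinset v) ∧ ∀ u v, G.Adj u v → u ∉ Np v → v ∈ Np u

/-- `v` permanently adopts the color `(ω v).2`: it tries that color, and no node of `N⁺(v)` tries
the same color. -/
def Adopts {V 𝒞 : Type*} (Np : V → Finset V) (ω : V → Bool × 𝒞) (v : V) : Prop :=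
  (ω v).1 = true ∧ ∀ u ∈ Np v, (ω u).1 = true → (ω u).2 ≠ (ω v).2

open scoped Classical in
/-- Chromatic slack of `v` counted in `T`: the number of neighbors of `v` in `T` that adopt a
permanent color outside of the original palette of `v`. -/
noncomputable def chromaticSlack {V 𝒞 : Type*} [Fintype V] (G : SimpleGraph V)
    [DecidableRel G.Adj] (Ψ : V → Finset 𝒞) (Np : V → Finset V) (T : Finset V)
    (ω : V → Bool × 𝒞) (v : V) : ℕ :=
  ((G.neighborFinset v).filter fun u => u ∈ T ∧ Adopts Np ω u ∧ (ω u).2 ∉ Ψ v).card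

/-- `x` minimizes `e_v + a_v + κ_v` over `v ∈ C` (with `κ` counted in `T`). -/
def IsLeader {V 𝒞 : Type*} [Fintype V] [DecidableEq V] (G : SimpleGraph V) [DecidableRel G.Adj]
    (Ψ : V → Finset 𝒞) (Np : V → Finset V) (T C : Finset V) (ω : V → Bool × 𝒞) (x : V) : Prop :=
  x ∈ C ∧ ∀ v ∈ C,
    externalDegree G C x + antiDegree G C x + chromaticSlack G Ψ Np T ω x ≤
      externalDegree G C v + antiDegree G C v + chromaticSlack G Ψ Np T ω v

/-! Let `v` minimize slackability in `C`, and let M be the larger of σ̄_C and ℓ. Palettes have size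
degree plus one, so η_v ≤ η̄_v and ζ_v + η_v ≤ M. The decomposition then forces e_v + a_v = O(M)
(`IsAlmostClique.antiDegree_le`, `IsACD.externalDegree_le`). Since κ_v is at most a sum of
independent indicators of mean at most M/10, κ_v < M except with probability exp(-M/2). Every leader
`x` then has e_x + a_x + κ_x = O(M).

It remains to exclude leaders whose slackability is a large multiple of M. Small e_x and a_v put
N[x] almost inside N[v], so ζ_x = O(M) (`IsAlmostClique.sparsity_le`) and the excess must be
discrepancy. Large discrepancy makes κ_x large except with probability 2 exp(-6M)
(`IsAlmostClique.measureReal_chromaticSlack_le`). As |C| ≤ 2Δ ≤ 2 exp(ℓ), a union bound over `C` is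
affordable.

The delicate point is this lower tail, because adoptions are dependent. The nodes trying a color
outside Ψ_x are independent. All but three per member of a maximal family of disjoint conflicts are
unrivaled (`exists_disjoint_conflicts`), and the size of such a family has a Poisson-type moment
generating function (`mgf_disjoint_events_le`). Colors popular among the external neighbors of `u`
are discarded; there are at most 2e_u of them, which is harmless because e_u is O(M) on average over
`C`. -/

/-! ### Sparsity as a count of nonadjacent pairs. -/

section graph
variable {V : Type*} [Fintype V] [DecidableEq V] (G : SimpleGraph V) [DecidableRel G.Adj]

/-- Closed neighborhood `N[v]`. -/
def closedNeighborFinset (v : V) : Finset V := insert v (G.neighborFinset v)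

/-- Ordered pairs of distinct nonadjacent nodes in the closed neighborhood of `v`. -/
def nonadjacentPairs (v : V) : Finset (V × V) :=
  (closedNeighborFinset G v ×ˢ closedNeighborFinset G v).filter
    fun p => p.2 ∉ closedNeighborFinset G p.1

variable {G}

lemma mem_closedNeighborFinset {v w : V} : w ∈ closedNeighborFinset G v ↔ w = v ∨ G.Adj v w := by
  simp [closedNeighborFinset]

lemma card_closedNeighborFinset (v : V) : (closedNeighborFinset G v).card = G.degree v + 1 := by
  simp [closedNeighborFinset]

variable (G) in
lemma sum_card_neighborFinset_inter (S : Finset V) :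
    ∑ y ∈ S, (G.neighborFinset y ∩ S).card = 2 * edgesWithin G S := by
  -- The handshake lemma is applied to the graph induced on `S`, kept on the vertex type `V` with
  -- all other nodes isolated.
  let H : SimpleGraph V :=
    { Adj := fun a b => G.Adj a b ∧ a ∈ S ∧ b ∈ S
      symm := ⟨fun a b h => ⟨h.1.symm, h.2.2, h.2.1⟩⟩
      loopless := ⟨fun a h => G.loopless.irrefl a h.1⟩ }
  have : DecidableRel H.Adj := fun a b => by dsimp [H]; infer_instance
  have hE : H.edgeFinset = G.edgeFinset ∩ S.sym2 := by
    ext e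
    induction e with
    | _ a b => simp [H]
  have hdeg : ∀ y, H.degree y = if y ∈ S then (G.neighborFinset y ∩ S).card else 0 := by
    intro y
    rw [← SimpleGraph.card_neighborFinset_eq_degree]
    split_ifs with hy
    · congr 1; ext z; simp [H, hy]
    · rw [Finset.card_eq_zero]; ext z; simp [H, hy]
  have := H.sum_degrees_eq_twice_card_edges
  rw [hE] at this
  rw [edgesWithin, ← this]
  simp [hdeg, Finset.sum_ite_mem]

lemma card_closed_sdiff_closed {v y : V} (h : G.Adj v y) :
    (closedNeighborFinset G v \ closedNeighborFinset G y).card +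
      (G.neighborFinset y ∩ G.neighborFinset v).card + 1 = G.degree v := by
  have h1 := Finset.card_sdiff_add_card_inter (closedNeighborFinset G v) (closedNeighborFinset G y)
  have h2 : closedNeighborFinset G v ∩ closedNeighborFinset G y =
      insert v (insert y (G.neighborFinset y ∩ G.neighborFinset v)) := by
    ext z
    simp only [Finset.mem_inter, mem_closedNeighborFinset, Finset.mem_insert,
      SimpleGraph.mem_neighborFinset]
    constructor
    · tauto
    · rintro (rfl | rfl | h') <;> simp_all [G.adj_comm]
  rw [h2, Finset.card_insert_of_notMem, Finset.card_insert_of_notMem,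
    card_closedNeighborFinset] at h1
  · omega
  · simp
  · simp [h.ne]

lemma card_nonadjacentPairs_eq_sum (v : V) :
    (nonadjacentPairs G v).card =
      ∑ y ∈ G.neighborFinset v, (closedNeighborFinset G v \ closedNeighborFinset G y).card := by
  have h : (nonadjacentPairs G v).card =
      ∑ y ∈ closedNeighborFinset G v,
        (closedNeighborFinset G v \ closedNeighborFinset G y).card := by
    rw [nonadjacentPairs, Finset.card_filter, Finset.sum_product]
    refine Finset.sum_congr rfl fun y _ => ?_
    rw [← Finset.filter_notMem_eq_sdiff, Finset.card_filter]
  rw [h]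
  conv_lhs => rw [closedNeighborFinset]
  rw [Finset.sum_insert (by simp)]
  simp [closedNeighborFinset]

/-- For a neighbor y of v, N[v] consists of N[v] \ N[y], the common neighbors, v and y. Summing over
y counts every edge inside N(v) twice. This form avoids division and is what makes sparsities of
different nodes comparable. -/
lemma two_mul_degree_mul_sparsity (v : V) :
    2 * (G.degree v : ℝ) * sparsity G v = (nonadjacentPairs G v).card := by
  have h1 := sum_card_neighborFinset_inter G (G.neighborFinset v)
  have h2 : ∑ y ∈ G.neighborFinset v,
      ((closedNeighborFinset G v \ closedNeighborFinset G y).card +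
        (G.neighborFinset y ∩ G.neighborFinset v).card + 1) =
      ∑ y ∈ G.neighborFinset v, G.degree v :=
    Finset.sum_congr rfl fun y hy => card_closed_sdiff_closed (by simpa using hy)
  rw [Finset.sum_add_distrib, Finset.sum_add_distrib, ← card_nonadjacentPairs_eq_sum, h1] at h2
  simp only [Finset.sum_const, SimpleGraph.card_neighborFinset_eq_degree, smul_eq_mul] at h2
  have h3 : ((nonadjacentPairs G v).card : ℝ) + 2 * edgesWithin G (G.neighborFinset v) +
      G.degree v * 1 = G.degree v * G.degree v := by exact_mod_cast h2
  rw [sparsity, Nat.cast_choose_two]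
  rcases eq_or_ne (G.degree v) 0 with h0 | h0
  · simp only [h0] at h3 ⊢
    have : (0 : ℝ) ≤ edgesWithin G (G.neighborFinset v) := by positivity
    have : (0 : ℝ) ≤ (nonadjacentPairs G v).card := by positivity
    norm_num at h3 ⊢
    linarith
  · have : (G.degree v : ℝ) ≠ 0 := by exact_mod_cast h0
    field_simp
    linarith

lemma sparsity_nonneg (v : V) : 0 ≤ sparsity G v := by
  rcases Nat.eq_zero_or_pos (G.degree v) with h0 | h0
  · simp [sparsity, h0]
  · have h := two_mul_degree_mul_sparsity (G := G) v
    have h1 : (0 : ℝ) < 2 * G.degree v := by positivity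
    have h2 : (0 : ℝ) ≤ (nonadjacentPairs G v).card := by positivity
    exact nonneg_of_mul_nonneg_right (h ▸ h2) h1

omit [DecidableEq V] in
lemma unevenness_nonneg (v : V) : 0 ≤ unevenness G v :=
  Finset.sum_nonneg fun _ _ => by positivity

/-- A pair counted for u but not for v has a coordinate in N[u] \ N[v]. -/
lemma card_nonadjacentPairs_le (u v : V) :
    (nonadjacentPairs G u).card ≤ (nonadjacentPairs G v).card +
      2 * (closedNeighborFinset G u \ closedNeighborFinset G v).card * (G.degree u + 1) := by
  set D := closedNeighborFinset G u \ closedNeighborFinset G v with hD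
  have h : nonadjacentPairs G u ⊆ nonadjacentPairs G v ∪
      (D ×ˢ closedNeighborFinset G u ∪ closedNeighborFinset G u ×ˢ D) := by
    rintro ⟨y, z⟩ h
    simp only [nonadjacentPairs, Finset.mem_filter, Finset.mem_product, Finset.mem_union, hD,
      Finset.mem_sdiff] at h ⊢
    tauto
  refine (Finset.card_le_card h).trans ((Finset.card_union_le _ _).trans ?_)
  gcongr
  refine (Finset.card_union_le _ _).trans ?_
  rw [Finset.card_product, Finset.card_product, card_closedNeighborFinset]
  exact le_of_eq (by ring)

/-- `ζ_u` is controlled by `ζ_v` when the closed neighborhood of `u` barely leaves that of `v`. -/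
lemma degree_mul_sparsity_le (u v : V) :
    G.degree u * sparsity G u ≤ G.degree v * sparsity G v +
      (closedNeighborFinset G u \ closedNeighborFinset G v).card * ((G.degree u : ℝ) + 1) := by
  have h : ((nonadjacentPairs G u).card : ℝ) ≤ (nonadjacentPairs G v).card +
      2 * (closedNeighborFinset G u \ closedNeighborFinset G v).card * (G.degree u + 1) := by
    exact_mod_cast card_nonadjacentPairs_le u v
  rw [← two_mul_degree_mul_sparsity, ← two_mul_degree_mul_sparsity] at h
  linarith

omit [Fintype V] [DecidableEq V] in
lemma disparity_le_one {𝒞 : Type*} [DecidableEq 𝒞] (Ψ : V → Finset 𝒞) (u v : V) :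
    disparity Ψ u v ≤ 1 :=
  div_le_one_of_le₀ (by exact_mod_cast Finset.card_le_card Finset.sdiff_subset) (by positivity)

-- A palette of size d_u + 1 has at least d_u - d_v colors outside one of size d_v + 1.
omit [DecidableEq V] in
lemma unevenness_le_discrepancy {𝒞 : Type*} [DecidableEq 𝒞] {Ψ : V → Finset 𝒞}
    (hΨ : ∀ v, (Ψ v).card = G.degree v + 1) (v : V) :
    unevenness G v ≤ discrepancy G Ψ v := by
  refine Finset.sum_le_sum fun u _ => ?_
  rw [disparity, hΨ u]
  push_cast
  gcongr
  refine max_le (by positivity) ?_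
  have h := Finset.le_card_sdiff (Ψ v) (Ψ u)
  rw [hΨ, hΨ] at h
  have h' : G.degree u ≤ (Ψ u \ Ψ v).card + G.degree v := by omega
  have : (G.degree u : ℝ) ≤ (Ψ u \ Ψ v).card + G.degree v := by exact_mod_cast h'
  linarith

end graph

/-! ### Anti-degree, sparsity and average external degree inside one almost-clique. -/

section almostClique

/-- The conditions that an almost-clique decomposition imposes on a single almost-clique. -/
structure IsAlmostClique {V : Type*} [Fintype V] [DecidableEq V] (G : SimpleGraph V)
    [DecidableRel G.Adj] (ε : ℝ) (C : Finset V) : Prop where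
  nonempty : C.Nonempty
  degree_le : ∀ v ∈ C, (G.degree v : ℝ) ≤ (1 + ε) * (C.card : ℝ)
  card_le : ∀ v ∈ C, (C.card : ℝ) ≤ (1 + ε) * ((G.neighborFinset v ∩ C).card : ℝ)

variable {V : Type*} [Fintype V] [DecidableEq V] {G : SimpleGraph V} [DecidableRel G.Adj]

lemma IsACD.isAlmostClique {ε εsp : ℝ} {Vsp Vun : Finset V} {cliques : Finset (Finset V)}
    (h : IsACD G ε εsp Vsp Vun cliques) {C : Finset V} (hC : C ∈ cliques) :
    IsAlmostClique G ε C :=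
  ⟨h.nonempty C hC, h.degree_le C hC, h.card_le C hC⟩

namespace IsAlmostClique

variable {ε : ℝ} {C : Finset V}

lemma degree_le_two_mul (h : IsAlmostClique G ε C) (hε : ε < 1) {v : V} (hv : v ∈ C) :
    (G.degree v : ℝ) ≤ 2 * C.card :=
  (h.degree_le v hv).trans (by gcongr; linarith)

lemma card_le_two_mul_inter (h : IsAlmostClique G ε C) (hε : ε < 1) {v : V} (hv : v ∈ C) :
    (C.card : ℝ) ≤ 2 * (G.neighborFinset v ∩ C).card :=
  (h.card_le v hv).trans (by gcongr; linarith)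

lemma card_le_two_mul_degree (h : IsAlmostClique G ε C) (hε : ε < 1) {v : V} (hv : v ∈ C) :
    (C.card : ℝ) ≤ 2 * G.degree v := by
  refine (h.card_le_two_mul_inter hε hv).trans ?_
  gcongr
  rw [← SimpleGraph.card_neighborFinset_eq_degree]
  exact Finset.card_le_card Finset.inter_subset_left

/-- If v has k neighbors in C, then k + 1 ≤ |C| ≤ (1 + ε)k, which fails for k = 0 and k = 1. -/
lemma two_le_degree (h : IsAlmostClique G ε C) (hε : ε < 1) {v : V} (hv : v ∈ C) :
    2 ≤ G.degree v := by
  set k := (G.neighborFinset v ∩ C).card with hk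
  have h1 : k + 1 ≤ C.card := by
    rw [hk, ← Finset.card_insert_of_notMem (a := v) (by simp)]
    exact Finset.card_le_card (by
      intro z; simp only [Finset.mem_insert, Finset.mem_inter]; rintro (rfl | h) <;> tauto)
  have h2 : k ≤ G.degree v := by
    rw [← SimpleGraph.card_neighborFinset_eq_degree]
    exact Finset.card_le_card Finset.inter_subset_left
  have h3 := h.card_le v hv
  rw [← hk] at h3
  have h4 : (k : ℝ) + 1 ≤ C.card := by exact_mod_cast h1
  refine le_trans ?_ h2
  by_contra hlt
  rcases (by omega : k = 0 ∨ k = 1) with h0 | h0 <;> rw [h0] at h3 h4 <;> push_cast at h3 h4 <;>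
    linarith

lemma one_le_card (h : IsAlmostClique G ε C) : (1 : ℝ) ≤ C.card := by
  exact_mod_cast h.nonempty.card_pos

/-- The closed neighborhoods of the neighbors of `v` in `C` barely leave that of `v`. -/
lemma sum_card_sdiff_le (h : IsAlmostClique G ε C) (hε : ε < 1) {v : V} (hv : v ∈ C) :
    ∑ y ∈ G.neighborFinset v ∩ C,
      ((closedNeighborFinset G y \ closedNeighborFinset G v).card : ℝ) ≤
      4 * C.card * (sparsity G v + unevenness G v) := by
  -- The two set differences differ in size by d_y - d_v. The excess of degree becomes an unevenness
  -- term because d_y + 1 ≤ 3|C|.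
  have h1 : ∀ y ∈ G.neighborFinset v ∩ C,
      ((closedNeighborFinset G y \ closedNeighborFinset G v).card : ℝ) ≤
        (closedNeighborFinset G v \ closedNeighborFinset G y).card +
        3 * C.card * (max 0 ((G.degree y : ℝ) - G.degree v) / ((G.degree y : ℝ) + 1)) := by
    intro y hy
    have hyC := (Finset.mem_inter.1 hy).2
    have e1 := Finset.card_sdiff_add_card_inter (closedNeighborFinset G y)
      (closedNeighborFinset G v)
    have e2 := Finset.card_sdiff_add_card_inter (closedNeighborFinset G v)
      (closedNeighborFinset G y)
    rw [card_closedNeighborFinset] at e1 e2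
    rw [Finset.inter_comm] at e2
    have e : ((closedNeighborFinset G y \ closedNeighborFinset G v).card : ℝ) + G.degree v =
        (closedNeighborFinset G v \ closedNeighborFinset G y).card + G.degree y := by
      exact_mod_cast (by omega : (closedNeighborFinset G y \ closedNeighborFinset G v).card +
        G.degree v = (closedNeighborFinset G v \ closedNeighborFinset G y).card + G.degree y)
    have hd := h.degree_le_two_mul hε hyC
    have hc := h.one_le_card
    set t := max 0 ((G.degree y : ℝ) - G.degree v) with ht
    have ht0 : 0 ≤ t := le_max_left _ _
    have ht1 : (G.degree y : ℝ) - G.degree v ≤ t := le_max_right _ _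
    have h3 : t ≤ 3 * C.card * (t / ((G.degree y : ℝ) + 1)) := by
      rw [mul_div_assoc', le_div_iff₀ (by positivity)]
      nlinarith
    linarith
  refine (Finset.sum_le_sum h1).trans ?_
  rw [Finset.sum_add_distrib, ← Finset.mul_sum]
  have h2 : ∑ y ∈ G.neighborFinset v ∩ C,
      ((closedNeighborFinset G v \ closedNeighborFinset G y).card : ℝ) ≤
      2 * G.degree v * sparsity G v := by
    rw [two_mul_degree_mul_sparsity, card_nonadjacentPairs_eq_sum]
    push_cast
    exact Finset.sum_le_sum_of_subset_of_nonneg Finset.inter_subset_left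
      fun _ _ _ => by positivity
  have h3 : ∑ y ∈ G.neighborFinset v ∩ C,
      max 0 ((G.degree y : ℝ) - G.degree v) / ((G.degree y : ℝ) + 1) ≤ unevenness G v :=
    Finset.sum_le_sum_of_subset_of_nonneg Finset.inter_subset_left fun _ _ _ => by positivity
  have hd := h.degree_le_two_mul hε hv
  have hc := h.one_le_card
  have hs := sparsity_nonneg (G := G) v
  have hu := unevenness_nonneg (G := G) v
  nlinarith [mul_le_mul_of_nonneg_left h3 (by positivity : (0 : ℝ) ≤ 3 * C.card),
    mul_le_mul_of_nonneg_right hd hs, mul_nonneg (by positivity : (0 : ℝ) ≤ C.card) hu]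

lemma mem_sdiff_closed {v w : V} :
    w ∈ C \ insert v (G.neighborFinset v) ↔ w ∈ C ∧ w ∉ closedNeighborFinset G v := by
  simp [closedNeighborFinset]

/-- Double counting of pairs (w, y), where w ∈ C is a non-neighbor of v and y ∈ C a common neighbor.
Each w has at least (2/(1+ε) - 1)|C| such y, while each y sees w inside N[y] \ N[v], whose sizes are
bounded in sum. -/
lemma antiDegree_le (h : IsAlmostClique G ε C) (hε₀ : 0 < ε) (hε : ε < 1) {v : V} (hv : v ∈ C) :
    (antiDegree G C v : ℝ) ≤ 4 * (1 + ε) / (1 - ε) * (sparsity G v + unevenness G v) := by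
  set A := C \ insert v (G.neighborFinset v) with hA
  have hcard : antiDegree G C v = A.card := rfl
  have h1 : ∀ w ∈ A, (1 - ε) / (1 + ε) * C.card ≤
      ((G.neighborFinset v ∩ C).filter fun y => G.Adj y w).card := by
    intro w hw
    have hwC : w ∈ C := (Finset.mem_sdiff.1 hw).1
    have e1 := h.card_le v hv
    have e2 := h.card_le w hwC
    have e3 : (G.neighborFinset v ∩ C).card + (G.neighborFinset w ∩ C).card ≤
        ((G.neighborFinset v ∩ C).filter fun y => G.Adj y w).card + C.card := by
      rw [← Finset.card_inter_add_card_union]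
      gcongr
      · intro z; simp [G.adj_comm]; tauto
      · exact Finset.union_subset Finset.inter_subset_right Finset.inter_subset_right
    have e3' : ((G.neighborFinset v ∩ C).card : ℝ) + (G.neighborFinset w ∩ C).card ≤
        ((G.neighborFinset v ∩ C).filter fun y => G.Adj y w).card + C.card := by
      exact_mod_cast e3
    rw [div_mul_eq_mul_div, div_le_iff₀ (by linarith)]
    nlinarith
  have h2 : ∑ w ∈ A, ((G.neighborFinset v ∩ C).filter fun y => G.Adj y w).card =
      ∑ y ∈ G.neighborFinset v ∩ C, (A.filter fun w => G.Adj y w).card := by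
    simp_rw [Finset.card_filter]
    exact Finset.sum_comm
  have h3 : ∀ y ∈ G.neighborFinset v ∩ C, (A.filter fun w => G.Adj y w).card ≤
      (closedNeighborFinset G y \ closedNeighborFinset G v).card := by
    intro y _
    refine Finset.card_le_card fun w hw => ?_
    rw [Finset.mem_filter, hA, mem_sdiff_closed] at hw
    rw [Finset.mem_sdiff, mem_closedNeighborFinset]
    tauto
  have h4 : (A.card : ℝ) * ((1 - ε) / (1 + ε) * C.card) ≤
      4 * C.card * (sparsity G v + unevenness G v) := by
    calc (A.card : ℝ) * ((1 - ε) / (1 + ε) * C.card)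
        = ∑ w ∈ A, (1 - ε) / (1 + ε) * (C.card : ℝ) := by simp
      _ ≤ ∑ w ∈ A, (((G.neighborFinset v ∩ C).filter fun y => G.Adj y w).card : ℝ) :=
        Finset.sum_le_sum h1
      _ = ∑ y ∈ G.neighborFinset v ∩ C, ((A.filter fun w => G.Adj y w).card : ℝ) := by
        exact_mod_cast h2
      _ ≤ ∑ y ∈ G.neighborFinset v ∩ C,
          ((closedNeighborFinset G y \ closedNeighborFinset G v).card : ℝ) :=
        Finset.sum_le_sum fun y hy => by exact_mod_cast h3 y hy
      _ ≤ _ := h.sum_card_sdiff_le hε hv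
  have hc := h.one_le_card
  have hp : 0 < 1 - ε := by linarith
  rw [hcard, div_mul_eq_mul_div, le_div_iff₀ hp]
  have h5 : (A.card : ℝ) * ((1 - ε) / (1 + ε)) ≤ 4 * (sparsity G v + unevenness G v) := by
    refine le_of_mul_le_mul_right ?_ (by linarith : (0 : ℝ) < C.card)
    linarith
  rw [mul_div_assoc', div_le_iff₀ (by linarith)] at h5
  linarith

/-- The sparsity of `x ∈ C` in terms of that of another node `v` of `C`. -/
lemma sparsity_le (h : IsAlmostClique G ε C) (hε : ε < 1) {v x : V} (hv : v ∈ C) (hx : x ∈ C) :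
    sparsity G x ≤ 4 * sparsity G v + 2 * (externalDegree G C x + antiDegree G C v) := by
  have h1 := degree_mul_sparsity_le (G := G) x v
  -- A node of N[x] missed by N[v] is either outside C, hence an external neighbor of x, or in C,
  -- hence an anti-neighbor of v.
  have h2 : (closedNeighborFinset G x \ closedNeighborFinset G v).card ≤
      externalDegree G C x + antiDegree G C v := by
    refine (Finset.card_le_card ?_).trans (Finset.card_union_le _ _)
    intro z
    rw [Finset.mem_union, mem_sdiff_closed, Finset.mem_sdiff, Finset.mem_sdiff,
      mem_closedNeighborFinset, SimpleGraph.mem_neighborFinset]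
    by_cases hz : z ∈ C
    · tauto
    · rintro ⟨rfl | h, _⟩ <;> tauto
  have h2' : ((closedNeighborFinset G x \ closedNeighborFinset G v).card : ℝ) ≤
      externalDegree G C x + antiDegree G C v := by exact_mod_cast h2
  have hx2 : (2 : ℝ) ≤ G.degree x := by exact_mod_cast h.two_le_degree hε hx
  have h3 := h.degree_le_two_mul hε hv
  have h4 := h.card_le_two_mul_degree hε hx
  have hs := sparsity_nonneg (G := G) v
  refine le_of_mul_le_mul_left ?_ (by linarith : (0 : ℝ) < G.degree x)
  nlinarith [mul_le_mul_of_nonneg_right (h3.trans (by linarith :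
    2 * (C.card : ℝ) ≤ 4 * G.degree x)) hs, mul_le_mul_of_nonneg_right h2'
    (by linarith : (0 : ℝ) ≤ (G.degree x : ℝ) + 1),
    (by positivity : (0 : ℝ) ≤ externalDegree G C x + antiDegree G C v)]

/-- If u is a neighbor of v, an external neighbor of u lies in N[u] \ N[v] or is external to v as
well. The a_v non-neighbors of v are charged the trivial bound 2|C| each. -/
lemma sum_externalDegree_le (h : IsAlmostClique G ε C) (hε : ε < 1) {v : V} (hv : v ∈ C) :
    ∑ u ∈ C, (externalDegree G C u : ℝ) ≤ C.card *
      (4 * (sparsity G v + unevenness G v) + externalDegree G C v + 2 * antiDegree G C v) := by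
  have hsplit : C = (G.neighborFinset v ∩ C) ∪ (insert v (C \ insert v (G.neighborFinset v))) := by
    ext z
    by_cases hz : z = v
    · simp [hz, hv]
    · simp [hz]; tauto
  have hdeg : ∀ u ∈ C, (externalDegree G C u : ℝ) ≤ 2 * C.card := fun u hu => by
    refine le_trans ?_ (h.degree_le_two_mul hε hu)
    rw [← SimpleGraph.card_neighborFinset_eq_degree]
    exact_mod_cast Finset.card_le_card Finset.sdiff_subset
  have h1 : ∀ u ∈ G.neighborFinset v ∩ C, (externalDegree G C u : ℝ) ≤
      (closedNeighborFinset G u \ closedNeighborFinset G v).card + externalDegree G C v := by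
    intro u _
    have : externalDegree G C u ≤
        (closedNeighborFinset G u \ closedNeighborFinset G v).card + externalDegree G C v := by
      refine (Finset.card_le_card ?_).trans (Finset.card_union_le _ _)
      intro z
      simp only [Finset.mem_union, Finset.mem_sdiff, mem_closedNeighborFinset,
        SimpleGraph.mem_neighborFinset]
      rintro ⟨h1, h2⟩
      by_cases hz : z = v
      · subst hz; exact absurd hv h2
      · tauto
    exact_mod_cast this
  have hN : ((G.neighborFinset v ∩ C).card : ℝ) + 1 ≤ C.card := by
    have : (insert v (G.neighborFinset v ∩ C)).card ≤ C.card := Finset.card_le_card (by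
      intro z; simp only [Finset.mem_insert, Finset.mem_inter]; rintro (rfl | h) <;> tauto)
    rw [Finset.card_insert_of_notMem (by simp)] at this
    exact_mod_cast this
  rw [Finset.sum_congr hsplit fun _ _ => rfl, Finset.sum_union, Finset.sum_insert (by simp)]
  · have h2 : ∑ u ∈ C \ insert v (G.neighborFinset v), (externalDegree G C u : ℝ) ≤
        antiDegree G C v * (2 * C.card) := by
      rw [antiDegree, ← nsmul_eq_mul]
      exact Finset.sum_le_card_nsmul _ _ _ fun u hu => hdeg u (Finset.mem_sdiff.1 hu).1
    have h3 := Finset.sum_le_sum h1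
    rw [Finset.sum_add_distrib, Finset.sum_const, nsmul_eq_mul] at h3
    have h4 := h.sum_card_sdiff_le hε hv
    nlinarith [(by positivity : (0 : ℝ) ≤ externalDegree G C v)]
  · rw [Finset.disjoint_left]
    intro z
    simp only [Finset.mem_inter, SimpleGraph.mem_neighborFinset, Finset.mem_insert,
      Finset.mem_sdiff]
    rintro ⟨h1, _⟩ (rfl | h3)
    · exact G.loopless.irrefl _ h1
    · tauto

end IsAlmostClique

end almostClique

/-! ### External degree, through stability of sparsity and unevenness. -/

section external

variable {V : Type*} [Fintype V] [DecidableEq V] {G : SimpleGraph V} [DecidableRel G.Adj]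

lemma card_closed_sdiff_comm (u v : V) :
    ((closedNeighborFinset G u \ closedNeighborFinset G v).card : ℝ) + G.degree v =
      (closedNeighborFinset G v \ closedNeighborFinset G u).card + G.degree u := by
  have e1 := Finset.card_sdiff_add_card_inter (closedNeighborFinset G u) (closedNeighborFinset G v)
  have e2 := Finset.card_sdiff_add_card_inter (closedNeighborFinset G v) (closedNeighborFinset G u)
  rw [card_closedNeighborFinset] at e1 e2
  rw [Finset.inter_comm] at e2
  exact_mod_cast (by omega : (closedNeighborFinset G u \ closedNeighborFinset G v).card +
    G.degree v = (closedNeighborFinset G v \ closedNeighborFinset G u).card + G.degree u)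

lemma unevenness_term_le {a b w : ℝ} (ha : 0 ≤ a) (hw : 0 ≤ w) :
    max 0 (w - a) / (w + 1) ≤ max 0 (w - b) / (w + 1) + max 0 (b - a) / (a + 1) := by
  rcases le_total w a with h | h
  · rw [max_eq_left (by linarith : w - a ≤ 0)]
    simp only [zero_div]
    positivity
  · calc max 0 (w - a) / (w + 1) ≤ (max 0 (w - b) + max 0 (b - a)) / (w + 1) := by
          gcongr
          refine max_le (by positivity) ?_
          linarith [le_max_right 0 (w - b), le_max_right 0 (b - a)]
      _ ≤ _ := by rw [add_div]; gcongr

/-- A neighbor of u outside N[v] contributes at most 1. For the others, replacing d_u by d_v costs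
at most (d_v - d_u)⁺/(d_u + 1) each, hence at most (d_v - d_u)⁺ in total. -/
lemma unevenness_le_add (u v : V) :
    unevenness G u ≤ unevenness G v +
      (closedNeighborFinset G u \ closedNeighborFinset G v).card +
      max 0 ((G.degree v : ℝ) - G.degree u) := by
  set f : V → V → ℝ := fun a w =>
    max 0 ((G.degree w : ℝ) - G.degree a) / ((G.degree w : ℝ) + 1) with hf
  set r := max 0 ((G.degree v : ℝ) - G.degree u) with hr
  have hr0 : 0 ≤ r := le_max_left _ _
  have hf0 : ∀ a w, 0 ≤ f a w := fun a w => by simp only [hf]; positivity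
  have hkey : ∀ w ∈ G.neighborFinset u, f u w ≤
      (if w ∈ closedNeighborFinset G v then 0 else 1) +
        (if w ∈ G.neighborFinset v then f v w else 0) + r / ((G.degree u : ℝ) + 1) := by
    intro w _
    have h0 : 0 ≤ r / ((G.degree u : ℝ) + 1) := by positivity
    have h1 : f u w ≤ f v w + r / ((G.degree u : ℝ) + 1) :=
      unevenness_term_le (by positivity) (by positivity)
    have h2 : f u w ≤ 1 := div_le_one_of_le₀ (max_le (by positivity) (by
      linarith [(by positivity : (0 : ℝ) ≤ G.degree u)])) (by positivity)
    by_cases hw : w ∈ closedNeighborFinset G v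
    · by_cases hv : w = v
      · subst hv
        have : f w w = 0 := by simp [hf]
        simp [mem_closedNeighborFinset]
        linarith
      · have : w ∈ G.neighborFinset v := by
          simpa [mem_closedNeighborFinset, hv] using hw
        simp only [hw, this, if_true]
        linarith
    · have := hf0 v w
      simp only [hw, if_false]
      split_ifs <;> linarith
  have hsum := Finset.sum_le_sum hkey
  rw [Finset.sum_add_distrib, Finset.sum_add_distrib] at hsum
  have s1 : ∑ w ∈ G.neighborFinset u, (if w ∈ closedNeighborFinset G v then (0 : ℝ) else 1) ≤
      (closedNeighborFinset G u \ closedNeighborFinset G v).card := by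
    have : ∀ w, (if w ∈ closedNeighborFinset G v then (0 : ℝ) else 1) =
        if w ∉ closedNeighborFinset G v then 1 else 0 := fun w => by split_ifs <;> simp_all
    simp_rw [this]
    rw [Finset.sum_boole, Finset.filter_notMem_eq_sdiff]
    exact_mod_cast Finset.card_le_card (Finset.sdiff_subset_sdiff
      (Finset.subset_insert _ _) subset_rfl)
  have s2 : ∑ w ∈ G.neighborFinset u, (if w ∈ G.neighborFinset v then f v w else 0) ≤
      unevenness G v := by
    rw [← Finset.sum_filter]
    refine Finset.sum_le_sum_of_subset_of_nonneg (fun w hw => (Finset.mem_filter.1 hw).2)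
      fun w _ _ => hf0 v w
  have s3 : ∑ w ∈ G.neighborFinset u, r / ((G.degree u : ℝ) + 1) ≤ r := by
    rw [Finset.sum_const, nsmul_eq_mul, SimpleGraph.card_neighborFinset_eq_degree, mul_div_assoc',
      div_le_iff₀ (by positivity)]
    nlinarith [(by positivity : (0 : ℝ) ≤ G.degree u)]
  have : unevenness G u = ∑ w ∈ G.neighborFinset u, f u w := rfl
  linarith

/-- Nodes with almost the same closed neighborhood have similar sparsity and unevenness. -/
lemma sparsity_add_unevenness_transfer {u v : V} {δ : ℝ} (hδ₀ : 0 ≤ δ) (hδ : δ ≤ 1 / 2)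
    (hu : 1 ≤ G.degree u) (hs : sparsity G v + unevenness G v ≤ δ * G.degree v)
    (h1 : ((closedNeighborFinset G v \ closedNeighborFinset G u).card : ℝ) ≤ δ * G.degree v)
    (h2 : (G.degree u : ℝ) ≤ (1 + δ) * G.degree v) :
    ((closedNeighborFinset G u \ closedNeighborFinset G v).card : ℝ) ≤ 2 * δ * G.degree v ∧
      (1 - δ) * G.degree v ≤ G.degree u ∧
      sparsity G u + unevenness G u ≤ 20 * δ * G.degree u := by
  have e := card_closed_sdiff_comm (G := G) u v
  have hζ := degree_mul_sparsity_le (G := G) u v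
  have hη := unevenness_le_add (G := G) u v
  have hζ0 := sparsity_nonneg (G := G) v
  have hη0 := unevenness_nonneg (G := G) v
  set D := ((closedNeighborFinset G u \ closedNeighborFinset G v).card : ℝ) with hD
  have hD0 : 0 ≤ D := by positivity
  have a1 : D ≤ 2 * δ * G.degree v := by linarith
  have a2 : (1 - δ) * G.degree v ≤ G.degree u := by linarith
  have hu' : (1 : ℝ) ≤ G.degree u := by exact_mod_cast hu
  have hv0 : (0 : ℝ) ≤ G.degree v := by positivity
  have a3 : (G.degree v : ℝ) ≤ 2 * G.degree u := by nlinarith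
  have a4 : max 0 ((G.degree v : ℝ) - G.degree u) ≤ δ * G.degree v :=
    max_le (by positivity) (by linarith)
  have a5 : sparsity G u ≤ 12 * δ * G.degree u := by
    refine le_of_mul_le_mul_left ?_ (by linarith : (0 : ℝ) < G.degree u)
    have b1 : (G.degree v : ℝ) * sparsity G v ≤ (2 * G.degree u) * (δ * (2 * G.degree u)) := by
      refine mul_le_mul a3 ?_ hζ0 (by positivity)
      nlinarith
    have b2 : D * ((G.degree u : ℝ) + 1) ≤ (2 * δ * (2 * G.degree u)) * (2 * G.degree u) := by
      refine mul_le_mul ?_ (by linarith) (by positivity) (by positivity)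
      nlinarith
    nlinarith
  have a6 : unevenness G u ≤ 8 * δ * G.degree u := by nlinarith
  exact ⟨a1, a2, by linarith⟩

variable {εacd εsp : ℝ} {Vsp Vun : Finset V} {cliques : Finset (Finset V)}

/-- Nodes of almost-cliques have similar closed neighborhoods only inside an almost-clique. -/
lemma IsACD.mem_of_similar (h : IsACD G εacd εsp Vsp Vun cliques) (hacd₀ : 0 < εacd)
    (hacd₁ : εacd < 1) (hsp₁ : εsp < 1) {C : Finset V} (hC : C ∈ cliques) {v u : V}
    (hv : v ∈ C) {δ γ : ℝ} (hγ : γ = (1 - εacd) / (1 + εacd)) (hδ₀ : 0 < δ)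
    (hδ₁ : 40 * δ ≤ εsp) (hδ₂ : 500 * δ ≤ γ ^ 2)
    (hd : 2 < γ * G.degree v) (hu : 1 ≤ G.degree u)
    (hs : sparsity G v + unevenness G v ≤ δ * G.degree v)
    (h1 : ((closedNeighborFinset G v \ closedNeighborFinset G u).card : ℝ) ≤ δ * G.degree v)
    (h2 : (G.degree u : ℝ) ≤ (1 + δ) * G.degree v) : u ∈ C := by
  obtain ⟨t1, t2, t3⟩ := sparsity_add_unevenness_transfer hδ₀.le (by linarith) hu hs h1 h2
  have hu' : (1 : ℝ) ≤ G.degree u := by exact_mod_cast hu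
  have hζ0 := sparsity_nonneg (G := G) u
  have hη0 := unevenness_nonneg (G := G) u
  have hδu : 0 < δ * G.degree u := by positivity
  have hεu : 40 * (δ * G.degree u) ≤ εsp * G.degree u := by nlinarith
  -- By transfer, ζ_u + η_u is at most εsp · d_u / 2, too small for a sparse or an uneven node.
  rcases h.cover u with hsp | hun | ⟨C', hC', huC'⟩
  · have := h.sparse u hsp
    linarith
  · have := h.uneven u hun
    linarith
  by_contra huC
  -- N[v] contains almost all of C, and, being close to N[u], almost all of the disjoint set C'.
  -- Their total size is at least about 2d_v/(1 + εacd) = (1 + γ)d_v, exceeding d_v + 1 since γ d_v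
  -- > 2.
  have hne : C ≠ C' := fun e => huC (e ▸ huC')
  have hdis := h.pairwise_disjoint C hC C' hC' hne
  have acC := h.isAlmostClique hC
  have acC' := h.isAlmostClique hC'
  have av := acC.antiDegree_le hacd₀ hacd₁ hv
  have au := acC'.antiDegree_le hacd₀ hacd₁ huC'
  have hγ0 : 0 < γ := by rw [hγ]; exact div_pos (by linarith) (by linarith)
  have hγ1 : γ < 1 := by rw [hγ, div_lt_one (by linarith)]; linarith
  have hγi : 4 * (1 + εacd) / (1 - εacd) = 4 / γ := by rw [hγ, div_div_eq_mul_div]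
  rw [hγi] at av au
  have hγε : 2 / (1 + εacd) = 1 + γ := by
    rw [hγ]; field_simp; ring
  have c1 : (C.card : ℝ) - antiDegree G C v ≤ (closedNeighborFinset G v ∩ C).card := by
    have := Finset.card_sdiff_add_card_inter C (insert v (G.neighborFinset v))
    rw [Finset.inter_comm] at this
    have : antiDegree G C v + (closedNeighborFinset G v ∩ C).card = C.card := this
    rw [← this]; push_cast; linarith
  have c2 : (C'.card : ℝ) - antiDegree G C' u ≤ (closedNeighborFinset G u ∩ C').card := by
    have := Finset.card_sdiff_add_card_inter C' (insert u (G.neighborFinset u))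
    rw [Finset.inter_comm] at this
    have : antiDegree G C' u + (closedNeighborFinset G u ∩ C').card = C'.card := this
    rw [← this]; push_cast; linarith
  have c3 : ((closedNeighborFinset G u ∩ C').card : ℝ) ≤ (closedNeighborFinset G v ∩ C').card +
      (closedNeighborFinset G u \ closedNeighborFinset G v).card := by
    have : (closedNeighborFinset G u ∩ C').card ≤ (closedNeighborFinset G v ∩ C').card +
        (closedNeighborFinset G u \ closedNeighborFinset G v).card := by
      refine (Finset.card_le_card ?_).trans (Finset.card_union_le _ _)
      intro z; simp only [Finset.mem_inter, Finset.mem_union, Finset.mem_sdiff]; tauto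
    exact_mod_cast this
  have c4 : ((closedNeighborFinset G v ∩ C).card : ℝ) + (closedNeighborFinset G v ∩ C').card ≤
      G.degree v + 1 := by
    have : (closedNeighborFinset G v ∩ C).card + (closedNeighborFinset G v ∩ C').card ≤
        G.degree v + 1 := by
      rw [← card_closedNeighborFinset, ← Finset.card_union_of_disjoint]
      · exact Finset.card_le_card
          (Finset.union_subset Finset.inter_subset_left Finset.inter_subset_left)
      · exact hdis.mono Finset.inter_subset_right Finset.inter_subset_right
    exact_mod_cast this
  have hv0 : (0 : ℝ) < G.degree v := by
    by_contra h0
    nlinarith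
  have b1 : (G.degree v : ℝ) / (1 + εacd) ≤ C.card := by
    rw [div_le_iff₀ (by linarith)]
    linarith [acC.degree_le v hv]
  have b2 : (G.degree u : ℝ) / (1 + εacd) ≤ C'.card := by
    rw [div_le_iff₀ (by linarith)]
    linarith [acC'.degree_le u huC']
  have b3 : (1 + γ) * (1 - δ / 2) * G.degree v ≤
      (G.degree v : ℝ) / (1 + εacd) + (G.degree u : ℝ) / (1 + εacd) := by
    rw [← hγε, ← add_div, div_mul_eq_mul_div, div_mul_eq_mul_div]
    gcongr
    linarith
  have b4 : 4 / γ * (sparsity G v + unevenness G v) ≤ 4 / γ * (δ * G.degree v) := by gcongr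
  have b5 : 4 / γ * (sparsity G u + unevenness G u) ≤ 4 / γ * (40 * δ * G.degree v) := by
    gcongr
    refine t3.trans ?_
    have : (G.degree u : ℝ) ≤ 2 * G.degree v := h2.trans (by gcongr; linarith only [hδ₁, hsp₁])
    linarith only [mul_le_mul_of_nonneg_left this hδ₀.le]
  have b6 : δ / γ ≤ γ / 500 := by
    rw [div_le_iff₀ hγ0]; linarith only [hδ₂]
  have b7 : 4 / γ * (δ * G.degree v) + 4 / γ * (40 * δ * G.degree v) ≤
      164 * (γ / 500) * G.degree v := by
    calc _ = 164 * (δ / γ) * G.degree v := by ring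
      _ ≤ _ := by gcongr
  have b8 : δ ≤ γ / 500 := by nlinarith only [hδ₂, hγ0, hγ1]
  have b9 : δ * G.degree v ≤ γ / 500 * G.degree v := by gcongr
  have b10 : γ * (δ * G.degree v) ≤ 1 * (δ * G.degree v) := by gcongr
  have b11 : (1 + γ) * (1 - δ / 2) * G.degree v =
      G.degree v + γ * G.degree v - δ * G.degree v / 2 - γ * (δ * G.degree v) / 2 := by ring
  have b12 : (G.degree v : ℝ) / (1 + εacd) + (G.degree u : ℝ) / (1 + εacd) ≤
      G.degree v + 1 + 2 * δ * G.degree v + antiDegree G C v + antiDegree G C' u := by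
    linarith only [b1, b2, c1, c2, c3, c4, t1]
  have b13 : (antiDegree G C v : ℝ) + antiDegree G C' u ≤ 164 * (γ / 500) * G.degree v := by
    linarith only [av, au, b4, b5, b7]
  linarith only [b3, b11, b12, b13, b9, b10, hd]

/-- The external degree of a node of an almost-clique is bounded by sparsity and unevenness. -/
lemma IsACD.externalDegree_le (h : IsACD G εacd εsp Vsp Vun cliques) (hacd₀ : 0 < εacd)
    (hacd₁ : εacd < 1) (hsp₁ : εsp < 1) {C : Finset V} (hC : C ∈ cliques) {v : V}
    (hv : v ∈ C) {δ γ : ℝ} (hγ : γ = (1 - εacd) / (1 + εacd)) (hδ₀ : 0 < δ)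
    (hδ₁ : 40 * δ ≤ εsp) (hδ₂ : 500 * δ ≤ γ ^ 2) :
    (externalDegree G C v : ℝ) ≤ 3 / δ * (sparsity G v + unevenness G v + 1) := by
  have hζ0 := sparsity_nonneg (G := G) v
  have hη0 := unevenness_nonneg (G := G) v
  have hγ0 : 0 < γ := by rw [hγ]; exact div_pos (by linarith) (by linarith)
  have hγ1 : γ < 1 := by rw [hγ, div_lt_one (by linarith)]; linarith
  have hed : (externalDegree G C v : ℝ) ≤ G.degree v := by
    rw [← SimpleGraph.card_neighborFinset_eq_degree]
    exact_mod_cast Finset.card_le_card Finset.sdiff_subset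
  rw [div_mul_eq_mul_div, le_div_iff₀ hδ₀]
  -- When ζ_v + η_v ≥ δ d_v or γ d_v ≤ 2, the trivial bound e_v ≤ d_v suffices.
  rcases le_or_gt (δ * G.degree v) (sparsity G v + unevenness G v) with hs | hs
  · nlinarith
  rcases le_or_gt (γ * G.degree v) 2 with hd | hd
  · have : δ ≤ γ := by nlinarith
    have : δ * externalDegree G C v ≤ γ * G.degree v := by gcongr
    linarith
  have hv0 : (2 : ℝ) ≤ G.degree v := by
    exact_mod_cast (h.isAlmostClique hC).two_le_degree hacd₁ hv
  -- An external neighbor cannot be similar to v, so it pays δ in sparsity or unevenness. The factor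
  -- 3 absorbs the passage from the denominator d_u + 1 to d_v.
  have hbad : ∀ u ∈ G.neighborFinset v \ C, δ ≤
      ((closedNeighborFinset G v \ closedNeighborFinset G u).card : ℝ) / G.degree v +
        3 * (max 0 ((G.degree u : ℝ) - G.degree v) / ((G.degree u : ℝ) + 1)) := by
    intro u hu
    rw [Finset.mem_sdiff, SimpleGraph.mem_neighborFinset] at hu
    have hu1 : 1 ≤ G.degree u := (G.degree_pos_iff_exists_adj u).2 ⟨v, hu.1.symm⟩
    by_contra hlt
    rw [not_le] at hlt
    have p1 : 0 ≤ ((closedNeighborFinset G v \ closedNeighborFinset G u).card : ℝ) /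
      G.degree v := by positivity
    have p2 : 0 ≤ max 0 ((G.degree u : ℝ) - G.degree v) / ((G.degree u : ℝ) + 1) := by positivity
    refine hu.2 (h.mem_of_similar hacd₀ hacd₁ hsp₁ hC hv hγ hδ₀ hδ₁ hδ₂ hd hu1 hs.le ?_ ?_)
    · rw [← div_le_iff₀ (by linarith)]
      linarith
    · have p3 : max 0 ((G.degree u : ℝ) - G.degree v) / ((G.degree u : ℝ) + 1) < δ / 3 := by
        linarith
      rw [div_lt_iff₀ (by positivity)] at p3
      have p4 := le_max_right 0 ((G.degree u : ℝ) - G.degree v)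
      have p5 : δ ≤ 1 / 40 := by linarith
      by_contra hgt
      nlinarith
  have hsum := Finset.card_nsmul_le_sum _ _ _ hbad
  rw [Finset.sum_add_distrib, ← Finset.sum_div, ← Finset.mul_sum, nsmul_eq_mul] at hsum
  have s1 : (∑ u ∈ G.neighborFinset v \ C,
      ((closedNeighborFinset G v \ closedNeighborFinset G u).card : ℝ)) / G.degree v ≤
      2 * sparsity G v := by
    rw [div_le_iff₀ (by linarith)]
    have := two_mul_degree_mul_sparsity (G := G) v
    rw [card_nonadjacentPairs_eq_sum] at this
    push_cast at this
    have h2 : ∑ u ∈ G.neighborFinset v \ C,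
      ((closedNeighborFinset G v \ closedNeighborFinset G u).card : ℝ) ≤
      ∑ u ∈ G.neighborFinset v,
      ((closedNeighborFinset G v \ closedNeighborFinset G u).card : ℝ) :=
      Finset.sum_le_sum_of_subset_of_nonneg Finset.sdiff_subset fun _ _ _ => by positivity
    linarith
  have s2 : ∑ u ∈ G.neighborFinset v \ C,
      max 0 ((G.degree u : ℝ) - G.degree v) / ((G.degree u : ℝ) + 1) ≤ unevenness G v :=
    Finset.sum_le_sum_of_subset_of_nonneg Finset.sdiff_subset fun _ _ _ => by positivity
  have : (externalDegree G C v : ℝ) = (G.neighborFinset v \ C).card := rfl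
  rw [this]
  linarith

end external

/-! ### Chernoff bounds for independent choices and for disjoint events. -/

section concentration

open ProbabilityTheory

variable {V A : Type*} [Fintype V] [Finite A] [MeasurableSpace A] [MeasurableSingletonClass A]
  (μ : V → Measure A) [∀ v, IsProbabilityMeasure (μ v)]

open scoped Classical in
/-- Moment generating function of the number of nodes whose choice hits a given set. -/
lemma mgf_card_filter_le (S : Finset V) (B : V → Set A) (t : ℝ) :
    mgf (fun ω : V → A => ((S.filter fun v => ω v ∈ B v).card : ℝ)) (Measure.pi μ) t ≤
      Real.exp ((Real.exp t - 1) * ∑ v ∈ S, (μ v).real (B v)) := by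
  have h1 : ∀ ω : V → A, Real.exp (t * ((S.filter fun v => ω v ∈ B v).card : ℝ)) =
      ∏ v, (if v ∈ S then (1 + (Real.exp t - 1) * (B v).indicator 1 (ω v)) else 1) := by
    intro ω
    rw [Finset.prod_ite_mem, Finset.univ_inter, Finset.card_filter]
    push_cast
    rw [Finset.mul_sum, Real.exp_sum]
    refine Finset.prod_congr rfl fun v _ => ?_
    by_cases h : ω v ∈ B v <;> simp [h]
  have h2 : ∀ v, ∫ a, (if v ∈ S then (1 + (Real.exp t - 1) * (B v).indicator 1 a) else 1) ∂μ v =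
      if v ∈ S then 1 + (Real.exp t - 1) * (μ v).real (B v) else 1 := by
    intro v
    split_ifs
    · rw [integral_add .of_finite .of_finite, integral_const_mul,
        integral_indicator_one (Set.toFinite _).measurableSet]
      simp
    · simp
  rw [mgf]
  simp_rw [h1]
  rw [integral_fintype_prod_eq_prod
    (f := fun v a => if v ∈ S then (1 + (Real.exp t - 1) * (B v).indicator 1 a) else (1 : ℝ))]
  simp_rw [h2]
  rw [Finset.prod_ite_mem, Finset.univ_inter, Finset.mul_sum, Real.exp_sum]
  refine Finset.prod_le_prod (fun v _ => ?_) fun v _ => ?_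
  · have : (μ v).real (B v) ≤ 1 := measureReal_le_one
    nlinarith [Real.exp_pos t, (measureReal_nonneg : 0 ≤ (μ v).real (B v))]
  · linarith [Real.add_one_le_exp ((Real.exp t - 1) * (μ v).real (B v))]

omit [Finite A] [MeasurableSingletonClass A] in
/-- Events with pairwise disjoint supports are independent. -/
lemma measureReal_pi_disjoint_supports {I : Type*} [DecidableEq V] (H : Finset I)
    (s : I → Finset V) (B : I → V → Set A) (hH : (H : Set I).PairwiseDisjoint s) :
    (Measure.pi μ).real {ω | ∀ i ∈ H, ∀ v ∈ s i, ω v ∈ B i v} =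
      ∏ i ∈ H, ∏ v ∈ s i, (μ v).real (B i v) := by
  have h1 : {ω : V → A | ∀ i ∈ H, ∀ v ∈ s i, ω v ∈ B i v} =
      Set.univ.pi fun v => {a | ∀ i ∈ H, v ∈ s i → a ∈ B i v} := by
    ext ω; simp only [Set.mem_ofPred_eq, Set.mem_pi, Set.mem_univ, true_imp_iff]; tauto
  rw [h1, measureReal_def, Measure.pi_pi, ENNReal.toReal_prod]
  have h2 : ∏ v, (μ v {a | ∀ i ∈ H, v ∈ s i → a ∈ B i v}).toReal =
      ∏ v ∈ H.biUnion s, (μ v {a | ∀ i ∈ H, v ∈ s i → a ∈ B i v}).toReal := by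
    refine (Finset.prod_subset (Finset.subset_univ _) fun v _ hv => ?_).symm
    have : {a | ∀ i ∈ H, v ∈ s i → a ∈ B i v} = Set.univ := by
      ext a
      simp only [Set.mem_ofPred_eq, Set.mem_univ, iff_true]
      exact fun i hi hv' => absurd (Finset.mem_biUnion.2 ⟨i, hi, hv'⟩) hv
    rw [this, measure_univ, ENNReal.toReal_one]
  rw [h2, Finset.prod_biUnion hH]
  refine Finset.prod_congr rfl fun i hi => Finset.prod_congr rfl fun v hv => ?_
  rw [measureReal_def]
  congr 2
  ext a
  refine ⟨fun h => h i hi hv, fun h j hj hv' => ?_⟩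
  have : j = i := by
    by_contra hne
    exact Finset.disjoint_left.1 (hH hj hi hne) hv' hv
  exact this ▸ h

/-- Moment generating function of the number of disjointly supported events that occur. -/
lemma mgf_disjoint_events_le {I : Type*} [DecidableEq V] (J : Finset I)
    (s : I → Finset V) (B : I → V → Set A) (F : (V → A) → Finset I)
    (hFJ : ∀ ω, F ω ⊆ J) (hF : ∀ ω, (F ω : Set I).PairwiseDisjoint s)
    (hFω : ∀ ω, ∀ i ∈ F ω, ∀ v ∈ s i, ω v ∈ B i v) {t : ℝ} (ht : 0 ≤ t) :
    mgf (fun ω => ((F ω).card : ℝ)) (Measure.pi μ) t ≤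
      Real.exp ((Real.exp t - 1) * ∑ i ∈ J, ∏ v ∈ s i, (μ v).real (B i v)) := by
  classical
  set E : Finset I → Set (V → A) := fun H => {ω | ∀ i ∈ H, ∀ v ∈ s i, ω v ∈ B i v} with hE
  set 𝓗 : Finset (Finset I) :=
    J.powerset.filter fun H : Finset I => (H : Set I).PairwiseDisjoint s with h𝓗
  set r := Real.exp t - 1 with hr
  have hr0 : 0 ≤ r := by linarith [Real.add_one_le_exp t]
  -- With r = exp(t) - 1, the expansion of (1 + r)^|F| runs over subfamilies H of F. These are again
  -- disjointly supported, so the probability that all of H occurs factors, although the events in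
  -- `J` may be dependent.
  have h1 : ∀ ω, Real.exp (t * ((F ω).card : ℝ)) ≤
      ∑ H ∈ 𝓗, r ^ H.card * (E H).indicator 1 ω := by
    intro ω
    calc Real.exp (t * ((F ω).card : ℝ)) = ∏ _i ∈ F ω, (1 + r) := by
          rw [Finset.prod_const, hr, add_sub_cancel, ← Real.exp_nat_mul, mul_comm]
      _ = ∑ H ∈ (F ω).powerset, r ^ H.card := by
          rw [Finset.prod_one_add]; simp
      _ = ∑ H ∈ (F ω).powerset, r ^ H.card * (E H).indicator 1 ω := by
          refine Finset.sum_congr rfl fun H hH => ?_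
          rw [Finset.mem_powerset] at hH
          rw [Set.indicator_of_mem (by exact fun i hi => hFω ω i (hH hi))]
          simp
      _ ≤ _ := by
          refine Finset.sum_le_sum_of_subset_of_nonneg (fun H hH => ?_) fun H _ _ => ?_
          · rw [Finset.mem_powerset] at hH
            exact Finset.mem_filter.2 ⟨Finset.mem_powerset.2 (hH.trans (hFJ ω)),
              (hF ω).subset (by exact_mod_cast hH)⟩
          · exact mul_nonneg (pow_nonneg hr0 _) (Set.indicator_nonneg (by simp) _)
  calc mgf (fun ω => ((F ω).card : ℝ)) (Measure.pi μ) t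
      ≤ ∫ ω, ∑ H ∈ 𝓗, r ^ H.card * (E H).indicator 1 ω ∂Measure.pi μ :=
        integral_mono .of_finite .of_finite h1
    _ = ∑ H ∈ 𝓗, r ^ H.card * ∏ i ∈ H, ∏ v ∈ s i, (μ v).real (B i v) := by
        rw [integral_finsetSum _ fun _ _ => .of_finite]
        refine Finset.sum_congr rfl fun H hH => ?_
        rw [integral_const_mul, integral_indicator_one (Set.toFinite _).measurableSet, hE,
          measureReal_pi_disjoint_supports μ H s B (Finset.mem_filter.1 hH).2]
    _ ≤ ∑ H ∈ J.powerset, r ^ H.card * ∏ i ∈ H, ∏ v ∈ s i, (μ v).real (B i v) :=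
        Finset.sum_le_sum_of_subset_of_nonneg (Finset.filter_subset _ _) fun H _ _ =>
          mul_nonneg (pow_nonneg hr0 _) (Finset.prod_nonneg fun _ _ => Finset.prod_nonneg
            fun _ _ => measureReal_nonneg)
    _ = ∏ i ∈ J, (1 + r * ∏ v ∈ s i, (μ v).real (B i v)) := by
        rw [Finset.prod_one_add]
        simp_rw [Finset.prod_mul_distrib, Finset.prod_const]
    _ ≤ _ := by
        rw [Finset.mul_sum, Real.exp_sum]
        refine Finset.prod_le_prod (fun i _ => ?_) fun i _ => ?_
        · have := mul_nonneg hr0 (Finset.prod_nonneg fun v (_ : v ∈ s i) =>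
            (measureReal_nonneg : 0 ≤ (μ v).real (B i v)))
          linarith
        · linarith [Real.add_one_le_exp (r * ∏ v ∈ s i, (μ v).real (B i v))]

open scoped Classical in
lemma measureReal_card_filter_le {S : Finset V} {B : V → Set A} {m : ℝ}
    (hm : ∑ v ∈ S, (μ v).real (B v) = m) :
    (Measure.pi μ).real {ω | ((S.filter fun v => ω v ∈ B v).card : ℝ) ≤ 9 / 10 * m} ≤
      Real.exp (-(m / 4000)) := by
  have hm0 : 0 ≤ m := hm ▸ Finset.sum_nonneg fun _ _ => measureReal_nonneg
  refine (measure_le_le_exp_mul_mgf (t := -(1 / 100)) _ (by norm_num) .of_finite).trans ?_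
  refine (mul_le_mul_of_nonneg_left (mgf_card_filter_le μ S B _) (Real.exp_pos _).le).trans ?_
  rw [hm, ← Real.exp_add, Real.exp_le_exp]
  have h := Real.abs_exp_sub_one_sub_id_le (x := -(1 / 100)) (by norm_num [abs_le])
  have h2 : Real.exp (-(1 / 100)) - 1 ≤ -(99 / 10000) := by
    linarith [(abs_le.1 h).2]
  nlinarith

open scoped Classical in
lemma measureReal_le_card_filter {S : Finset V} {B : V → Set A} {m : ℝ}
    (hm : ∑ v ∈ S, (μ v).real (B v) ≤ m / 10) :
    (Measure.pi μ).real {ω | m ≤ ((S.filter fun v => ω v ∈ B v).card : ℝ)} ≤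
      Real.exp (-(m / 2)) := by
  have hm0 : 0 ≤ m / 10 := le_trans (Finset.sum_nonneg fun _ _ => measureReal_nonneg) hm
  refine (measure_ge_le_exp_mul_mgf (t := 1) _ (by norm_num) .of_finite).trans ?_
  refine (mul_le_mul_of_nonneg_left (mgf_card_filter_le μ S B _) (Real.exp_pos _).le).trans ?_
  rw [← Real.exp_add, Real.exp_le_exp]
  have h : Real.exp 1 - 1 ≤ 2 := by linarith [Real.exp_one_lt_d9]
  have h0 : 0 ≤ Real.exp 1 - 1 := by linarith [Real.add_one_le_exp (1 : ℝ)]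
  nlinarith

/-- The constant 28/100 lies just above the mean bound 1/4, and three times it stays below the 9/10
of `measureReal_card_filter_le`. -/
lemma measureReal_le_card_disjoint_events {I : Type*} [DecidableEq V] {J : Finset I}
    {s : I → Finset V} {B : I → V → Set A} {F : (V → A) → Finset I}
    (hFJ : ∀ ω, F ω ⊆ J) (hF : ∀ ω, (F ω : Set I).PairwiseDisjoint s)
    (hFω : ∀ ω, ∀ i ∈ F ω, ∀ v ∈ s i, ω v ∈ B i v) {m : ℝ} (hm0 : 0 ≤ m)
    (hm : ∑ i ∈ J, ∏ v ∈ s i, (μ v).real (B i v) ≤ m / 4) :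
    (Measure.pi μ).real {ω | 28 / 100 * m ≤ ((F ω).card : ℝ)} ≤ Real.exp (-(m / 4000)) := by
  refine (measure_ge_le_exp_mul_mgf (t := 1 / 100) _ (by norm_num) .of_finite).trans ?_
  refine (mul_le_mul_of_nonneg_left (mgf_disjoint_events_le μ J s B F hFJ hF hFω (by norm_num))
    (Real.exp_pos _).le).trans ?_
  rw [← Real.exp_add, Real.exp_le_exp]
  have h := Real.abs_exp_sub_one_sub_id_le (x := 1 / 100) (by norm_num [abs_le])
  have h2 : Real.exp (1 / 100) - 1 ≤ 101 / 10000 := by linarith [(abs_le.1 h).2]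
  have h0 : 0 ≤ Real.exp (1 / 100) - 1 := by linarith [Real.add_one_le_exp (1 / 100 : ℝ)]
  nlinarith

end concentration

/-! ### Unrivaled nodes via a maximal family of disjoint conflicts. -/

section conflicts

variable {V 𝒞 : Type*} [DecidableEq V] [DecidableEq 𝒞]

/-- The choices of a node that tries a color of `A`. -/
def triesIn (A : Finset 𝒞) : Set (Bool × 𝒞) := {true} ×ˢ (A : Set 𝒞)

omit [DecidableEq 𝒞] in
lemma mem_triesIn {A : Finset 𝒞} {p : Bool × 𝒞} : p ∈ triesIn A ↔ p.1 = true ∧ p.2 ∈ A := by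
  simp [triesIn]

/-- The potential conflicts: a node `u ∈ D`, a rival `w ∈ R u`, and a color of `A u`. -/
def potentialConflicts (D : Finset V) (R : V → Finset V) (A : V → Finset 𝒞) :
    Finset ((_ : V) × (V × 𝒞)) :=
  D.sigma fun u => R u ×ˢ A u

/-- The two nodes of a conflict. -/
def conflictNodes (i : (_ : V) × (V × 𝒞)) : Finset V := {i.1, i.2.1}

open scoped Classical in
/-- All but boundedly many, per disjoint conflict, of the nodes trying a target color are
unrivaled. -/
lemma exists_disjoint_conflicts (D : Finset V) (R : V → Finset V) (A : V → Finset 𝒞)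
    (hR : ∀ u ∈ D, ∀ u' ∈ D, u ≠ u' → u' ∈ R u) (ω : V → Bool × 𝒞) :
    ∃ F ⊆ potentialConflicts D R A,
      (F : Set ((_ : V) × (V × 𝒞))).PairwiseDisjoint conflictNodes ∧
      (∀ i ∈ F, ∀ v ∈ conflictNodes i, ω v ∈ triesIn {i.2.2}) ∧
      (D.filter fun u => ω u ∈ triesIn (A u)).card ≤
        (D.filter fun u => ω u ∈ triesIn (A u) ∧ ∀ w ∈ R u, ω w ≠ ω u).card + 3 * F.card := by
  set 𝓕 : Finset (Finset ((_ : V) × (V × 𝒞))) := (potentialConflicts D R A).powerset.filter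
    fun F => (F : Set ((_ : V) × (V × 𝒞))).PairwiseDisjoint conflictNodes ∧
      ∀ i ∈ F, ∀ v ∈ conflictNodes i, ω v ∈ triesIn {i.2.2} with h𝓕
  obtain ⟨F, hF, hmax⟩ := Finset.exists_max_image 𝓕 Finset.card ⟨∅, by simp [h𝓕]⟩
  obtain ⟨hFJ, hdisj, hpres⟩ := Finset.mem_filter.1 hF
  rw [Finset.mem_powerset] at hFJ
  refine ⟨F, hFJ, hdisj, hpres, ?_⟩
  set S := F.biUnion conflictNodes with hS
  have hScard : S.card ≤ 2 * F.card := by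
    rw [mul_comm]
    exact Finset.card_biUnion_le_card_mul _ _ _ fun i _ => Finset.card_le_two
  -- Otherwise the conflict of u with w could be added to the maximal family.
  have hmeet : ∀ u ∈ D, ω u ∈ triesIn (A u) → ∀ w ∈ R u, ω w = ω u → u ∉ S → w ∈ S := by
    intro u hu hAu w hw hwu huS
    by_contra hwS
    set i : (_ : V) × (V × 𝒞) := ⟨u, (w, (ω u).2)⟩ with hi
    have hiF : i ∉ F := fun h => huS (Finset.mem_biUnion.2 ⟨i, h, by simp [conflictNodes, hi]⟩)
    have hin : insert i F ∈ 𝓕 := by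
      refine Finset.mem_filter.2 ⟨?_, ?_, ?_⟩
      · rw [Finset.mem_powerset, Finset.insert_subset_iff]
        refine ⟨?_, hFJ⟩
        simp only [potentialConflicts, Finset.mem_sigma, Finset.mem_product, hi]
        exact ⟨hu, hw, (mem_triesIn.1 hAu).2⟩
      · rw [Finset.coe_insert]
        refine hdisj.insert_of_notMem (by exact_mod_cast hiF) fun j hj => ?_
        rw [Finset.disjoint_left]
        intro z hz hzj
        have hzS : z ∈ S := Finset.mem_biUnion.2 ⟨j, by exact_mod_cast hj, hzj⟩
        simp only [conflictNodes, Finset.mem_insert, Finset.mem_singleton, hi] at hz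
        rcases hz with rfl | rfl <;> contradiction
      · intro j hj
        rcases Finset.mem_insert.1 hj with rfl | hj
        · have h1 := (mem_triesIn.1 hAu).1
          intro z hz
          simp only [conflictNodes, Finset.mem_insert, Finset.mem_singleton, hi] at hz
          rw [mem_triesIn]
          rcases hz with rfl | rfl <;> simp [hi, h1, hwu]
        · exact hpres j hj
    have := hmax _ hin
    rw [Finset.card_insert_of_notMem hiF] at this
    omega
  set X := D.filter fun u => ω u ∈ triesIn (A u) with hX
  set Z := D.filter fun u => ω u ∈ triesIn (A u) ∧ ∀ w ∈ R u, ω w ≠ ω u with hZ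
  set K := (X \ Z) \ S with hK
  have hKmem : ∀ u ∈ K, u ∈ D ∧ ω u ∈ triesIn (A u) ∧ u ∉ S ∧
      ∃ i ∈ F, i.2.2 = (ω u).2 := by
    intro u hu
    simp only [hK, hX, hZ, Finset.mem_sdiff, Finset.mem_filter, not_and] at hu
    obtain ⟨⟨⟨huD, huA⟩, hnot⟩, huS⟩ := hu
    have := hnot huD huA
    push Not at this
    obtain ⟨w, hw, hwu⟩ := this
    obtain ⟨i, hi, hwi⟩ := Finset.mem_biUnion.1 (hmeet u huD huA w hw hwu huS)
    have := (mem_triesIn.1 (hpres i hi w hwi)).2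
    rw [Finset.mem_singleton, hwu] at this
    exact ⟨huD, huA, huS, i, hi, this.symm⟩
  -- A rivaled node outside S shares its color with a conflict of F. Two such nodes of equal color
  -- would rival each other, putting one of them in S, so colors are distinct on K.
  have hKcard : K.card ≤ F.card := by
    refine (Finset.card_le_card_of_injOn (t := F.image fun i => i.2.2) (fun u => (ω u).2)
      (fun u hu => ?_) fun u hu u' hu' huu' => ?_).trans Finset.card_image_le
    · obtain ⟨-, -, -, i, hi, e⟩ := hKmem u hu
      exact Finset.mem_coe.2 (Finset.mem_image.2 ⟨i, hi, e⟩)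
    · obtain ⟨hD, hA, hnS, -⟩ := hKmem u hu
      obtain ⟨hD', hA', hnS', -⟩ := hKmem u' hu'
      by_contra hne
      refine hnS' (hmeet u hD hA u' (hR u hD u' hD' hne) ?_ hnS)
      exact Prod.ext ((mem_triesIn.1 hA').1.trans (mem_triesIn.1 hA).1.symm) huu'.symm
  have h1 : X ⊆ Z ∪ (S ∪ K) := by
    intro u hu
    simp only [hK, Finset.mem_union, Finset.mem_sdiff]
    tauto
  calc X.card ≤ Z.card + (S.card + K.card) := (Finset.card_le_card h1).trans
        ((Finset.card_union_le _ _).trans (by gcongr; exact Finset.card_union_le _ _))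
    _ ≤ _ := by omega

open scoped Classical in
/-- Lower tail of the number of unrivaled nodes. -/
lemma measureReal_unrivaled_le [Fintype V] [Finite 𝒞] [MeasurableSpace 𝒞]
    [MeasurableSingletonClass 𝒞] (μ : V → Measure (Bool × 𝒞)) [∀ v, IsProbabilityMeasure (μ v)]
    (D : Finset V) (R : V → Finset V) (A : V → Finset 𝒞)
    (hR : ∀ u ∈ D, ∀ u' ∈ D, u ≠ u' → u' ∈ R u) (hRu : ∀ u ∈ D, u ∉ R u)
    (hw : ∀ u ∈ D, ∀ c ∈ A u, ∑ w ∈ R u, (μ w).real (triesIn {c}) ≤ 1 / 4) {m : ℝ}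
    (hm : ∑ u ∈ D, (μ u).real (triesIn (A u)) = m) :
    (Measure.pi μ).real {ω | ((D.filter fun u => ω u ∈ triesIn (A u) ∧
      ∀ w ∈ R u, ω w ≠ ω u).card : ℝ) ≤ m / 20} ≤ 2 * Real.exp (-(m / 4000)) := by
  choose F hFJ hF hFω hFc using exists_disjoint_conflicts D R A hR
  have hm0 : 0 ≤ m := hm ▸ Finset.sum_nonneg fun _ _ => measureReal_nonneg
  have hA : ∀ u, ∑ c ∈ A u, (μ u).real (triesIn {c}) = (μ u).real (triesIn (A u)) := by
    intro u
    rw [← measureReal_biUnion_finset]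
    · congr 1
      ext p
      simp [mem_triesIn]
    · intro c _ c' _ hne
      rw [Function.onFun, Set.disjoint_left]
      intro p hp hp'
      simp only [mem_triesIn, Finset.mem_singleton] at hp hp'
      exact hne (hp.2.symm.trans hp'.2)
    · exact fun c _ => (Set.toFinite _).measurableSet
  have hsum : ∑ i ∈ potentialConflicts D R A, ∏ v ∈ conflictNodes i,
      (μ v).real (triesIn {i.2.2}) ≤ m / 4 := by
    rw [potentialConflicts, Finset.sum_sigma, ← hm, Finset.sum_div]
    refine Finset.sum_le_sum fun u hu => ?_
    rw [Finset.sum_product_right, ← hA, Finset.sum_div]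
    refine Finset.sum_le_sum fun c hc => ?_
    have : ∀ w ∈ R u, ∏ v ∈ conflictNodes ⟨u, (w, c)⟩, (μ v).real (triesIn {c}) =
        (μ u).real (triesIn {c}) * (μ w).real (triesIn {c}) := fun w hw =>
      Finset.prod_pair (fun e : u = w => hRu u hu (e ▸ hw))
    rw [Finset.sum_congr rfl this, ← Finset.mul_sum]
    have := mul_le_mul_of_nonneg_left (hw u hu c hc)
      (measureReal_nonneg (μ := μ u) (s := triesIn {c}))
    linarith
  have h1 := measureReal_card_filter_le μ (S := D) (B := fun u => triesIn (A u)) hm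
  have h2 := measureReal_le_card_disjoint_events μ (F := F)
    (s := conflictNodes) (J := potentialConflicts D R A)
    (B := fun (i : (_ : V) × (V × 𝒞)) _ => triesIn {i.2.2})
    hFJ hF hFω hm0 hsum
  refine (measureReal_mono (s₂ := _ ∪ _) (fun ω hω => ?_)).trans
    ((measureReal_union_le _ _).trans ((add_le_add h1 h2).trans_eq (two_mul _).symm))
  simp only [Set.mem_union, Set.mem_ofPred_eq] at hω ⊢
  by_contra hcon
  push Not at hcon
  have h3 : ((D.filter fun u => ω u ∈ triesIn (A u)).card : ℝ) ≤
      (D.filter fun u => ω u ∈ triesIn (A u) ∧ ∀ w ∈ R u, ω w ≠ ω u).card +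
        3 * (F ω).card := by exact_mod_cast hFc ω
  -- Off both bad events the count exceeds (9/10 - 3 · 28/100)m = 6m/100 > m/20.
  linarith [hcon.1, hcon.2]

end conflicts

/-! ### Upper and lower tails of the chromatic slack. -/

section slackGeneration

open ProbabilityTheory

section law

variable {𝒞 : Type*} [MeasurableSpace 𝒞] [DiscreteMeasurableSpace 𝒞] {P : Finset 𝒞}

lemma isProbabilityMeasure_nodeLaw (hP : P.Nonempty) : IsProbabilityMeasure (nodeLaw P) := by
  have h1 : IsProbabilityMeasure
      ((1 / 10 : ENNReal) • Measure.dirac true + (9 / 10 : ENNReal) • Measure.dirac false) := by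
    constructor
    simp only [Measure.coe_add, Measure.coe_smul, Pi.add_apply, Pi.smul_apply, measure_univ,
      smul_eq_mul, mul_one]
    rw [← ENNReal.add_div, show (1 + 9 : ENNReal) = 10 by norm_num]
    exact ENNReal.div_self (by norm_num) (by norm_num)
  have h2 : IsProbabilityMeasure (uniformOn (P : Set 𝒞)) :=
    isProbabilityMeasure_uniformOn P.finite_toSet hP
  unfold nodeLaw
  infer_instance

lemma nodeLaw_real_triesIn [DecidableEq 𝒞] (A : Finset 𝒞) :
    (nodeLaw P).real (triesIn A) = 1 / 10 * (((P ∩ A).card : ℝ) / P.card) := by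
  rw [nodeLaw, triesIn, measureReal_prod_prod, measureReal_def, measureReal_def,
    uniformOn_apply_finset]
  congr 1
  · simp
  · simp [ENNReal.toReal_div]

lemma nodeLaw_real_triesIn_singleton_le [DecidableEq 𝒞] (c : 𝒞) :
    (nodeLaw P).real (triesIn {c}) = 1 / 10 * ((if c ∈ P then 1 else 0) / P.card) := by
  rw [nodeLaw_real_triesIn, Finset.inter_singleton]
  split_ifs <;> simp

end law

variable {V : Type*} [Fintype V] [DecidableEq V] {G : SimpleGraph V} [DecidableRel G.Adj]
  {𝒞 : Type*} [Fintype 𝒞] [DecidableEq 𝒞] {Ψ : V → Finset 𝒞} {Np : V → Finset V}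

omit [Fintype 𝒞] in
open scoped Classical in
lemma chromaticSlack_eq_card_filter (T : Finset V) (ω : V → Bool × 𝒞) (v : V) :
    chromaticSlack G Ψ Np T ω v = ((G.neighborFinset v).filter fun u =>
      u ∈ T ∧ Adopts Np ω u ∧ (ω u).2 ∉ Ψ v).card := by
  unfold chromaticSlack
  congr!

open scoped Classical in
lemma chromaticSlack_le (T : Finset V) (ω : V → Bool × 𝒞) (v : V) :
    chromaticSlack G Ψ Np T ω v ≤
      ((G.neighborFinset v).filter fun u => ω u ∈ triesIn (Finset.univ \ Ψ v)).card := by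
  rw [chromaticSlack_eq_card_filter]
  refine Finset.card_le_card fun u hu => ?_
  obtain ⟨h1, -, h2, h3⟩ := Finset.mem_filter.1 hu
  exact Finset.mem_filter.2 ⟨h1, mem_triesIn.2 ⟨h2.1, by simpa using h3⟩⟩

-- Rivals include all of C and all neighbors of u, hence all of N⁺(u). An unrivaled node therefore
-- adopts its color whatever the conflict sets are.
omit [Fintype 𝒞] in
open scoped Classical in
lemma card_unrivaled_le_chromaticSlack (hNp : IsConflictRelation G Np) {C T : Finset V}
    (hCT : C ⊆ T) {x : V} {A : V → Finset 𝒞} (hA : ∀ u, Disjoint (A u) (Ψ x))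
    (ω : V → Bool × 𝒞) :
    ((G.neighborFinset x ∩ C).filter fun u => ω u ∈ triesIn (A u) ∧
      ∀ w ∈ (C ∪ G.neighborFinset u).erase u, ω w ≠ ω u).card ≤ chromaticSlack G Ψ Np T ω x := by
  rw [chromaticSlack_eq_card_filter]
  refine Finset.card_le_card fun u hu => ?_
  rw [Finset.mem_filter, Finset.mem_inter, mem_triesIn] at hu
  obtain ⟨⟨huN, huC⟩, ⟨h1, h2⟩, h3⟩ := hu
  refine Finset.mem_filter.2 ⟨huN, hCT huC, ⟨h1, fun w hw hw1 hw2 => ?_⟩, Finset.disjoint_left.1 (hA u) h2⟩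
  have hwN := hNp.1 u hw
  refine h3 w (Finset.mem_erase.2 ⟨?_, Finset.mem_union_right _ hwN⟩)
    (Prod.ext (hw1.trans h1.symm) hw2)
  rintro rfl
  simp at hwN

variable [MeasurableSpace 𝒞] [DiscreteMeasurableSpace 𝒞]

omit [Fintype 𝒞] [DecidableEq V] [DecidableEq 𝒞] in
lemma isProbabilityMeasure_slackGenerationLaw (hΨ : ∀ v, (Ψ v).Nonempty) :
    IsProbabilityMeasure (slackGenerationLaw Ψ) := by
  have := fun v => isProbabilityMeasure_nodeLaw (hΨ v)
  unfold slackGenerationLaw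
  infer_instance

/-- Upper tail of the chromatic slack. -/
lemma measureReal_le_chromaticSlack (hΨ : ∀ v, (Ψ v).Nonempty) (T : Finset V) {v : V} {M : ℝ}
    (hM : discrepancy G Ψ v ≤ M) :
    (slackGenerationLaw Ψ).real {ω | M ≤ chromaticSlack G Ψ Np T ω v} ≤ Real.exp (-(M / 2)) := by
  classical
  have := isProbabilityMeasure_slackGenerationLaw hΨ
  have := fun v => isProbabilityMeasure_nodeLaw (hΨ v)
  refine le_trans ?_ (measureReal_le_card_filter (fun v => nodeLaw (Ψ v))
    (S := G.neighborFinset v) (B := fun _ => triesIn (Finset.univ \ Ψ v)) (m := M) ?_)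
  · refine measureReal_mono (μ := slackGenerationLaw Ψ) fun ω hω => ?_
    have hω' : M ≤ (chromaticSlack G Ψ Np T ω v : ℝ) := hω
    exact hω'.trans (by exact_mod_cast chromaticSlack_le T ω v)
  · have h1 : ∀ u, (nodeLaw (Ψ u)).real (triesIn (Finset.univ \ Ψ v)) =
        1 / 10 * disparity Ψ u v := fun u => by
      rw [nodeLaw_real_triesIn, disparity]
      congr 4
      ext c; simp
    simp_rw [h1]
    rw [← Finset.mul_sum]
    change 1 / 10 * discrepancy G Ψ v ≤ _
    linarith

/-- The colors of `u` outside the palette of `x` that few external neighbors may try. -/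
noncomputable def quietColors (G : SimpleGraph V) [DecidableRel G.Adj] (Ψ : V → Finset 𝒞)
    (C : Finset V) (x u : V) : Finset 𝒞 :=
  (Ψ u \ Ψ x).filter fun c =>
    ∑ w ∈ G.neighborFinset u \ C, (if c ∈ Ψ w then (1 : ℝ) else 0) / (Ψ w).card ≤ 1 / 2

omit [Fintype 𝒞] [MeasurableSpace 𝒞] [DiscreteMeasurableSpace 𝒞] in
lemma quietColors_subset (C : Finset V) (x u : V) : quietColors G Ψ C x u ⊆ Ψ u \ Ψ x :=
  Finset.filter_subset _ _

-- Markov's inequality: each external neighbor spreads total weight at most 1 over the colors, so at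
-- most 2e_u colors have weight above 1/2.
omit [Fintype 𝒞] [MeasurableSpace 𝒞] [DiscreteMeasurableSpace 𝒞] in
lemma card_sdiff_le_card_quietColors (C : Finset V) (x u : V) :
    ((Ψ u \ Ψ x).card : ℝ) ≤ (quietColors G Ψ C x u).card + 2 * externalDegree G C u := by
  set f : 𝒞 → ℝ := fun c =>
    ∑ w ∈ G.neighborFinset u \ C, (if c ∈ Ψ w then (1 : ℝ) else 0) / (Ψ w).card with hf
  set B := (Ψ u \ Ψ x).filter fun c => ¬ f c ≤ 1 / 2 with hB
  have h1 : ((Ψ u \ Ψ x).card : ℝ) = (quietColors G Ψ C x u).card + B.card := by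
    exact_mod_cast (Finset.card_filter_add_card_filter_not (fun c => f c ≤ 1 / 2)).symm
  have h2 : (B.card : ℝ) * (1 / 2) ≤ ∑ c ∈ B, f c := by
    rw [← nsmul_eq_mul]
    exact Finset.card_nsmul_le_sum _ _ _ fun c hc => (not_le.1 (Finset.mem_filter.1 hc).2).le
  have h3 : ∑ c ∈ B, f c ≤ externalDegree G C u := by
    simp only [hf]
    rw [Finset.sum_comm, externalDegree, ← mul_one ((Finset.card _ : ℕ) : ℝ), ← nsmul_eq_mul]
    refine Finset.sum_le_card_nsmul _ _ _ fun w _ => ?_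
    rw [← Finset.sum_div, Finset.sum_boole]
    refine div_le_one_of_le₀ ?_ (by positivity)
    exact_mod_cast Finset.card_le_card fun c hc => (Finset.mem_filter.1 hc).2
  linarith

/-- Lower tail of the chromatic slack of a node of an almost-clique. -/
lemma IsAlmostClique.measureReal_chromaticSlack_le {ε : ℝ} {C : Finset V}
    (h : IsAlmostClique G ε C) (hε : ε < 1) (hΨ : ∀ v, (Ψ v).card = G.degree v + 1)
    (hNp : IsConflictRelation G Np) {T : Finset V} (hCT : C ⊆ T) {v x : V} (hv : v ∈ C)
    {m : ℝ} (hm : 10 * m ≤ discrepancy G Ψ x - externalDegree G C x -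
      4 * (4 * (sparsity G v + unevenness G v) + externalDegree G C v + 2 * antiDegree G C v)) :
    (slackGenerationLaw Ψ).real {ω | (chromaticSlack G Ψ Np T ω x : ℝ) ≤ m / 20} ≤
      2 * Real.exp (-(m / 4000)) := by
  classical
  have hne : ∀ v, (Ψ v).Nonempty := fun v => Finset.card_pos.1 (by rw [hΨ]; omega)
  have := isProbabilityMeasure_slackGenerationLaw hne
  have := fun v => isProbabilityMeasure_nodeLaw (hne v)
  have hc := h.one_le_card
  have hpal : ∀ w ∈ C, (C.card : ℝ) ≤ 2 * (Ψ w).card := fun w hw => by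
    rw [hΨ]
    push_cast
    linarith [h.card_le_two_mul_degree hε hw]
  set D := G.neighborFinset x ∩ C with hD
  set A := quietColors G Ψ C x with hA
  set R : V → Finset V := fun u => (C ∪ G.neighborFinset u).erase u with hR
  set q := ∑ u ∈ D, (nodeLaw (Ψ u)).real (triesIn (A u)) with hq
  have hmq : m ≤ q := by
    -- The 2e_u discarded colors cost at most 4e_u/|C| of disparity, because |Ψ_u| ≥ |C|/2.
    have h1 : ∀ u ∈ D, 1 / 10 * (disparity Ψ u x - 4 / C.card * externalDegree G C u) ≤
        (nodeLaw (Ψ u)).real (triesIn (A u)) := by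
      intro u hu
      have huC : u ∈ C := (Finset.mem_inter.1 hu).2
      have hp : (0 : ℝ) < (Ψ u).card := by exact_mod_cast (hne u).card_pos
      rw [nodeLaw_real_triesIn, Finset.inter_eq_right.2
        ((quietColors_subset C x u).trans Finset.sdiff_subset), disparity]
      gcongr
      have e1 : 2 * (externalDegree G C u : ℝ) / (Ψ u).card ≤
          4 / C.card * externalDegree G C u := by
        rw [div_mul_eq_mul_div, div_le_div_iff₀ hp (by linarith)]
        nlinarith [hpal u huC, (by positivity : (0 : ℝ) ≤ externalDegree G C u)]
      have e2 := div_le_div_of_nonneg_right (card_sdiff_le_card_quietColors (G := G) (Ψ := Ψ)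
        C x u) hp.le
      rw [add_div] at e2
      linarith
    have h2 := Finset.sum_le_sum h1
    rw [← Finset.mul_sum, Finset.sum_sub_distrib, ← Finset.mul_sum] at h2
    have h3 : discrepancy G Ψ x - externalDegree G C x ≤ ∑ u ∈ D, disparity Ψ u x := by
      have e : discrepancy G Ψ x =
          ∑ u ∈ D, disparity Ψ u x + ∑ u ∈ G.neighborFinset x \ C, disparity Ψ u x :=
        (Finset.sum_inter_add_sum_sdiff _ _ _).symm
      have e' : ∑ u ∈ G.neighborFinset x \ C, disparity Ψ u x ≤
          (G.neighborFinset x \ C).card • (1 : ℝ) :=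
        Finset.sum_le_card_nsmul _ _ _ fun u _ => disparity_le_one Ψ u x
      rw [nsmul_eq_mul, mul_one] at e'
      rw [externalDegree]
      linarith
    have h4 : ∑ u ∈ D, (externalDegree G C u : ℝ) ≤ ∑ u ∈ C, (externalDegree G C u : ℝ) :=
      Finset.sum_le_sum_of_subset_of_nonneg Finset.inter_subset_right fun _ _ _ => by positivity
    have h5 := mul_le_mul_of_nonneg_left (h4.trans (h.sum_externalDegree_le hε hv))
      (by positivity : (0 : ℝ) ≤ 4 / C.card)
    rw [← mul_assoc, div_mul_cancel₀ _ (by linarith)] at h5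
    linarith
  -- Nodes of C contribute at most (1/10) · 2, as their palettes have size at least |C|/2; external
  -- neighbors contribute at most (1/10) · (1/2) because c is quiet.
  have hw : ∀ u ∈ D, ∀ c ∈ A u, ∑ w ∈ R u, (nodeLaw (Ψ w)).real (triesIn {c}) ≤ 1 / 4 := by
    intro u _ c hcA
    have h1 : R u ⊆ C ∪ (G.neighborFinset u \ C) := by
      rw [Finset.union_sdiff_self_eq_union]
      exact Finset.erase_subset _ _
    refine (Finset.sum_le_sum_of_subset_of_nonneg h1 fun _ _ _ => measureReal_nonneg).trans ?_
    rw [Finset.sum_union Finset.disjoint_sdiff]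
    simp_rw [nodeLaw_real_triesIn_singleton_le, ← Finset.mul_sum]
    have h2 := (Finset.mem_filter.1 hcA).2
    have h3 : ∑ w ∈ C, (if c ∈ Ψ w then (1 : ℝ) else 0) / (Ψ w).card ≤ C.card • (2 / C.card) := by
      refine Finset.sum_le_card_nsmul _ _ _ fun w hw => ?_
      have hp : (0 : ℝ) < (Ψ w).card := by exact_mod_cast (hne w).card_pos
      rw [div_le_div_iff₀ hp (by linarith)]
      have := hpal w hw
      split_ifs <;> linarith
    rw [nsmul_eq_mul, mul_div_cancel₀ _ (by linarith)] at h3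
    linarith
  have key := measureReal_unrivaled_le (fun v => nodeLaw (Ψ v)) D R A
    (fun u hu u' hu' hne => Finset.mem_erase.2
      ⟨hne.symm, Finset.mem_union_left _ (Finset.mem_inter.1 hu').2⟩)
    (fun u _ => Finset.notMem_erase _ _) hw hq.symm
  refine le_trans (measureReal_mono (μ := slackGenerationLaw Ψ) fun ω hω => ?_) (key.trans ?_)
  · have hω' : (chromaticSlack G Ψ Np T ω x : ℝ) ≤ m / 20 := hω
    refine le_trans ?_ (hω'.trans (by linarith : m / 20 ≤ q / 20))
    exact_mod_cast card_unrivaled_le_chromaticSlack hNp hCT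
      (fun u => Finset.disjoint_of_subset_left (quietColors_subset C x u)
        Finset.sdiff_disjoint) ω
  · gcongr

end slackGeneration

/-! ### Union bound over candidate leaders, and the choice of constants. -/

section leader

lemma exp_neg_half_add_le {M : ℝ} (hM : 1 ≤ M) :
    Real.exp (-(M / 2)) + 4 * Real.exp (-(5 * M)) ≤ Real.exp (-(1 / 4 * M)) := by
  set y := Real.exp (-(1 / 4 * M)) with hy
  have h1 : Real.exp (-(M / 2)) = y ^ 2 := by rw [hy, ← Real.exp_nat_mul]; congr 1; push_cast; ring
  have h2 : Real.exp (-(5 * M)) = y ^ 20 := by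
    rw [hy, ← Real.exp_nat_mul]; congr 1; push_cast; ring
  have hy0 : 0 < y := Real.exp_pos _
  have hy1 : y ≤ 4 / 5 := by
    rw [hy, Real.exp_neg, inv_le_comm₀ (Real.exp_pos _) (by norm_num)]
    linarith [Real.add_one_le_exp (1 / 4 * M)]
  have h3 : y ^ 19 ≤ (4 / 5 : ℝ) ^ 19 := by gcongr
  rw [h1, h2]
  nlinarith [(by norm_num : (4 / 5 : ℝ) ^ 19 ≤ 1 / 20)]

lemma log_le_slackThreshold {Δ : ℕ} (hΔ : 2 ≤ Δ) :
    1 ≤ slackThreshold Δ ∧ Real.log Δ ≤ slackThreshold Δ := by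
  have hΔ' : (2 : ℝ) ≤ Δ := by exact_mod_cast hΔ
  have h1 : 1 ≤ Real.logb 2 Δ := by
    rw [Real.le_logb_iff_rpow_le (by norm_num) (by linarith)]
    simpa using hΔ'
  have h2 : Real.logb 2 Δ ≤ slackThreshold Δ := by
    rw [slackThreshold]
    exact Real.self_le_rpow_of_one_le h1 (by norm_num)
  refine ⟨h1.trans h2, le_trans ?_ h2⟩
  rw [Real.logb, le_div_iff₀ (Real.log_pos (by norm_num))]
  have := Real.log_nonneg (by linarith : (1 : ℝ) ≤ Δ)
  nlinarith [Real.log_two_lt_d9]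

variable {V : Type*} [Fintype V] [DecidableEq V] {G : SimpleGraph V} [DecidableRel G.Adj]
  {𝒞 : Type*} [Fintype 𝒞] [DecidableEq 𝒞] [MeasurableSpace 𝒞] [DiscreteMeasurableSpace 𝒞]
  {Ψ : V → Finset 𝒞} {Np : V → Finset V}

/-- A leader has small slackability, given a node `v` of small slackability and bounds on its
external degree and anti-degree. -/
lemma IsAlmostClique.leader_slackability_le {ε : ℝ} {C : Finset V}
    (h : IsAlmostClique G ε C) (hε : ε < 1) (hΨ : ∀ v, (Ψ v).card = G.degree v + 1)
    (hNp : IsConflictRelation G Np) {T : Finset V} (hCT : C ⊆ T) {v : V} (hv : v ∈ C)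
    {M K₁ K : ℝ} (hM : 1 ≤ M) (hK₁ : 0 ≤ K₁) (hσ : slackability G Ψ v ≤ M)
    (hea : (externalDegree G C v : ℝ) + antiDegree G C v ≤ K₁ * M)
    (hC : (C.card : ℝ) ≤ 2 * Real.exp M) (hK : K = 250000 + 300 * K₁) :
    1 - Real.exp (-(1 / 4 * M)) ≤ (slackGenerationLaw Ψ).real
      {ω | ∀ x, IsLeader G Ψ Np T C ω x → slackability G Ψ x ≤ K * M} := by
  classical
  have hne : ∀ v, (Ψ v).Nonempty := fun v => Finset.card_pos.1 (by rw [hΨ]; omega)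
  have := isProbabilityMeasure_slackGenerationLaw hne
  have hζ0 := sparsity_nonneg (G := G) v
  have hη0 := unevenness_nonneg (G := G) v
  have hηd := unevenness_le_discrepancy hΨ v
  have hσ' : sparsity G v + discrepancy G Ψ v ≤ M := hσ
  have he0 : (0 : ℝ) ≤ externalDegree G C v := by positivity
  have ha0 : (0 : ℝ) ≤ antiDegree G C v := by positivity
  -- Chosen so that Q/4000 ≥ 6, which beats the union bound over C, and Q/20 ≥ K₁ + 1, which exceeds
  -- what a leader can have. K is 10Q with room for the sparsity and degree terms.
  set Q := 24000 + 20 * K₁ with hQ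
  set X := C.filter fun x => K * M < slackability G Ψ x ∧
    (externalDegree G C x : ℝ) ≤ (K₁ + 1) * M with hX
  have hx : ∀ x ∈ X, (slackGenerationLaw Ψ).real
      {ω | (chromaticSlack G Ψ Np T ω x : ℝ) ≤ Q * M / 20} ≤ 2 * Real.exp (-(6 * M)) := by
    intro x hx
    obtain ⟨hxC, hxσ, hxe⟩ := Finset.mem_filter.1 hx
    have hsp := h.sparsity_le hε hv hxC
    have hxσ' : K * M < sparsity G x + discrepancy G Ψ x := hxσ
    have hKM : 0 ≤ K₁ * M := by positivity
    refine (h.measureReal_chromaticSlack_le (m := Q * M) hε hΨ hNp hCT hv ?_).trans ?_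
    · rw [hK] at hxσ'
      rw [hQ]
      linarith
    · gcongr
      rw [hQ]
      linarith
  have hfail : (slackGenerationLaw Ψ).real
      {ω | ∀ x, IsLeader G Ψ Np T C ω x → slackability G Ψ x ≤ K * M}ᶜ ≤
      Real.exp (-(1 / 4 * M)) := by
    refine le_trans (measureReal_mono (s₂ := {ω | M ≤ chromaticSlack G Ψ Np T ω v} ∪
      ⋃ x ∈ X, {ω | (chromaticSlack G Ψ Np T ω x : ℝ) ≤ Q * M / 20}) fun ω hω => ?_) ?_
    · simp only [Set.mem_compl_iff, Set.mem_ofPred_eq, not_forall, not_le] at hω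
      obtain ⟨x, ⟨hxC, hlead⟩, hxσ⟩ := hω
      by_cases hκ : M ≤ chromaticSlack G Ψ Np T ω v
      · exact Or.inl hκ
      right
      rw [not_le] at hκ
      have hl : (externalDegree G C x : ℝ) + antiDegree G C x + chromaticSlack G Ψ Np T ω x ≤
          externalDegree G C v + antiDegree G C v + chromaticSlack G Ψ Np T ω v := by
        exact_mod_cast hlead v hv
      have hxe0 : (0 : ℝ) ≤ externalDegree G C x := by positivity
      have hxa0 : (0 : ℝ) ≤ antiDegree G C x := by positivity
      have hxκ0 : (0 : ℝ) ≤ chromaticSlack G Ψ Np T ω x := by positivity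
      refine Set.mem_iUnion₂.2 ⟨x, Finset.mem_filter.2 ⟨hxC, hxσ, by linarith⟩, ?_⟩
      change (chromaticSlack G Ψ Np T ω x : ℝ) ≤ Q * M / 20
      rw [hQ]
      linarith
    · have h1 : (slackGenerationLaw Ψ).real (⋃ x ∈ X,
          {ω | (chromaticSlack G Ψ Np T ω x : ℝ) ≤ Q * M / 20}) ≤ 4 * Real.exp (-(5 * M)) := by
        refine (measureReal_biUnion_finset_le _ _).trans
          ((Finset.sum_le_card_nsmul _ _ _ hx).trans ?_)
        rw [nsmul_eq_mul]
        have hXC : (X.card : ℝ) ≤ 2 * Real.exp M :=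
          le_trans (by exact_mod_cast Finset.card_filter_le _ _) hC
        refine (mul_le_mul_of_nonneg_right hXC (by positivity)).trans_eq ?_
        rw [show -(5 * M) = M + -(6 * M) by ring, Real.exp_add]
        ring
      refine (measureReal_union_le _ _).trans ((add_le_add
        (measureReal_le_chromaticSlack hne T (by linarith)) h1).trans (exp_neg_half_add_le hM))
  rw [probReal_compl_eq_one_sub (Set.toFinite _).measurableSet] at hfail
  linarith

end leader

theorem mainTheorem10 (εacd εsp : ℝ) (hacd₀ : 0 < εacd) (hacd₁ : εacd < 1)
    (hsp₀ : 0 < εsp) (hsp₁ : εsp < 1) :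
    ∃ K > (0 : ℝ), ∃ c > (0 : ℝ),
      ∀ (V : Type*) [Fintype V] [DecidableEq V] (G : SimpleGraph V) [DecidableRel G.Adj]
        (𝒞 : Type*) [Fintype 𝒞] [DecidableEq 𝒞] [MeasurableSpace 𝒞] [DiscreteMeasurableSpace 𝒞]
        (Ψ : V → Finset 𝒞) (Np : V → Finset V) (Δ : ℕ)
        (Vsp Vun : Finset V) (cliques : Finset (Finset V)),
        (∀ v, (Ψ v).card = G.degree v + 1) →
        (∀ v, G.degree v ≤ Δ) →
        IsConflictRelation G Np →
        IsACD G εacd εsp Vsp Vun cliques →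
        ∀ C ∈ cliques, ∀ T : Finset V, (T = C ∨ T = Finset.univ) →
          (slackThreshold Δ < cliqueSlackability G Ψ C →
            1 - Real.exp (-(c * cliqueSlackability G Ψ C)) ≤
              (slackGenerationLaw Ψ).real {ω | ∀ x, IsLeader G Ψ Np T C ω x →
                slackability G Ψ x ≤ K * cliqueSlackability G Ψ C}) ∧
          (cliqueSlackability G Ψ C ≤ slackThreshold Δ →
            1 - Real.exp (-(c * slackThreshold Δ)) ≤
              (slackGenerationLaw Ψ).real {ω | ∀ x, IsLeader G Ψ Np T C ω x →
                slackability G Ψ x ≤ K * slackThreshold Δ}) := by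
  set γ := (1 - εacd) / (1 + εacd) with hγ
  have hγ0 : 0 < γ := div_pos (by linarith) (by linarith)
  have hγ1 : γ < 1 := by rw [hγ, div_lt_one (by linarith)]; linarith
  -- Small enough for both requirements of `IsACD.mem_of_similar`.
  set δ := εsp * γ ^ 2 / 500 with hδ
  have hδ0 : 0 < δ := by positivity
  have hδ1 : 40 * δ ≤ εsp := by
    have : γ ^ 2 ≤ 1 := pow_le_one₀ hγ0.le hγ1.le
    rw [hδ]; nlinarith
  have hδ2 : 500 * δ ≤ γ ^ 2 := by
    rw [hδ]; nlinarith [sq_nonneg γ]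
  set K₁ := 6 / δ + 4 / γ with hK₁
  have hK₁0 : 0 < K₁ := by positivity
  refine ⟨250000 + 300 * K₁, by positivity, 1 / 4, by norm_num, ?_⟩
  intro V _ _ G _ 𝒞 _ _ _ _ Ψ Np Δ Vsp Vun cliques hΨ hΔ hNp hacd C hC T hT
  have ac := hacd.isAlmostClique hC
  obtain ⟨v, hv, hvσ⟩ : ∃ v ∈ (C : Set V), slackability G Ψ v = cliqueSlackability G Ψ C :=
    Set.Nonempty.csInf_mem (ac.nonempty.to_set.image _) (C.finite_toSet.image _)
  rw [Finset.mem_coe] at hv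
  obtain ⟨hℓ1, hℓ⟩ := log_le_slackThreshold ((ac.two_le_degree hacd₁ hv).trans (hΔ v))
  have hCT : C ⊆ T := by
    rcases hT with rfl | rfl
    · exact subset_rfl
    · exact Finset.subset_univ _
  -- Both cases are instances: M = σ̄_C for high slack, M = ℓ for low slack. M ≥ ℓ ensures |C| ≤ 2Δ
  -- ≤ 2 exp(M).
  have main : ∀ M, slackThreshold Δ ≤ M → cliqueSlackability G Ψ C ≤ M →
      1 - Real.exp (-(1 / 4 * M)) ≤ (slackGenerationLaw Ψ).real
        {ω | ∀ x, IsLeader G Ψ Np T C ω x → slackability G Ψ x ≤ (250000 + 300 * K₁) * M} := by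
    intro M hM hσM
    have hM1 : 1 ≤ M := hℓ1.trans hM
    have hs : sparsity G v + unevenness G v ≤ M :=
      (add_le_add_right (unevenness_le_discrepancy hΨ v) _).trans (hvσ.le.trans hσM)
    refine ac.leader_slackability_le hacd₁ hΨ hNp hCT hv hM1 hK₁0.le (hvσ.le.trans hσM) ?_ ?_ rfl
    · have he := hacd.externalDegree_le hacd₀ hacd₁ hsp₁ hC hv hγ hδ0 hδ1 hδ2
      have ha := ac.antiDegree_le hacd₀ hacd₁ hv
      rw [show 4 * (1 + εacd) / (1 - εacd) = 4 / γ by rw [hγ, div_div_eq_mul_div]] at ha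
      have he' : 3 / δ * (sparsity G v + unevenness G v + 1) ≤ 3 / δ * (2 * M) := by
        gcongr; linarith
      have ha' : 4 / γ * (sparsity G v + unevenness G v) ≤ 4 / γ * M := by gcongr
      have : K₁ * M = 3 / δ * (2 * M) + 4 / γ * M := by rw [hK₁]; ring
      linarith
    · have h1 := ac.card_le_two_mul_degree hacd₁ hv
      have h2 : (G.degree v : ℝ) ≤ Δ := by exact_mod_cast hΔ v
      have h3 : (0 : ℝ) < Δ := by
        have : (2 : ℝ) ≤ G.degree v := by exact_mod_cast ac.two_le_degree hacd₁ hv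
        linarith
      have h4 : (Δ : ℝ) ≤ Real.exp M := (Real.log_le_iff_le_exp h3).1 (hℓ.trans hM)
      linarith
  exact ⟨fun hlt => main _ hlt.le le_rfl, fun hle => main _ le_rfl hle⟩
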